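/- Let $d\ge 2$, let $\mathcal X\subset\mathbb R^d$ be compact, let $\mathcal T\subset\mathbb R$ be a bounded interval, and let $\mathcal A$ be a $\sigma$-finite measure space (for example a finite set with the counting measure, or a compact subset of $\mathbb R^{d_a}$ with Lebesgue measure). $\mathcal X$ and $\mathcal T$ carry Lebesgue measure, and products carry the product measure. Let $\varrho\colon\mathcal A\to[0,\infty)$ be integrable; for each $\alpha\in\mathcal A$ let $\rho_\alpha\ge 0$ be an integrable function on $\mathcal X$ with $\int_{\mathcal X}\rho_\alpha(x)\,dx=1$; assume that $\mu(x,\alpha)=\varrho(\alpha)\rho_\alpha(x)$ is measurable on $\mathcal X\times\mathcal A$. Let $y_1,\dots,y_n\in\mathcal X$, let $c_1,\dots,c_n\colon\mathcal T\to(0,\infty)$ be integrable, and let $r>0$. Let $\delta(x,y)=\hat\delta(\|x-y\|_2)$, where $\hat\delta\colon[0,\infty)\to\mathbb R$ is continuous and convex, $\hat\delta(0)=0$, and $\hat\delta$ is differentiable on $(0,\infty)$ with $\hat\delta'>0$ there. Let $\ell\colon\mathcal T\times\mathcal A\to[0,\infty)$ be integrable, with $t\mapsto\ell(t,\alpha)$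 continuous on $\mathcal T$ for each $\alpha$. Consider the primal problem (STM) $$\sup_{\pi}\ \sum_{i=1}^n\int_{\mathcal X\times\mathcal A\times\mathcal T}\bigl(r-\delta(x,y_i)-\ell(t,\alpha)\bigr)\,\pi_i(x,\alpha,t)\,d(x,\alpha,t)$$ over all families $\pi=(\pi_i)_{i=1}^n$ of nonnegative measurable integrable functions on $\mathcal X\times\mathcal A\times\mathcal T$ such that $$\int_{\mathcal X\times\mathcal A}\pi_i(x,\alpha,t)\,d(x,\alpha)\le c_i(t)\quad\text{for all } t\in\mathcal T \text{ and all } i,$$ $$\sum_{i=1}^n\int_{\mathcal T}\pi_i(x,\alpha,t)\,dt\le\mu(x,\alpha)\quad\text{for all } (x,\alpha)\in\mathcal X\times\mathcal A,$$ and the dual problem (STM-D) $$\inf_{\phi,\varphi_1,\dots,\varphi_n}\ \int_{\mathcal X\times\mathcal A}\phi(x,\alpha)\,\mu(x,\alpha)\,d(x,\alpha)+\sum_{i=1}^n\int_{\mathcal T}\varphi_i(t)\,c_i(t)\,dt$$ over all measurable $\phi\colon\mathcal X\times\mathcal A\to[0,\infty)$ and $\varphi_i\colon\mathcal T\to[0,\infty)$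 such that $$\phi(x,\alpha)+\varphi_i(t)\ \ge\ r-\delta(x,y_i)-\ell(t,\alpha)\quad\text{for all } (x,\alpha,t)\in\mathcal X\times\mathcal A\times\mathcal T \text{ and all } i.$$ (A plan whose objective integral diverges has the value $-\infty$, and potentials whose objective integral diverges have the value $+\infty$.) Then strong duality holds: the supremum in (STM) and the infimum in (STM-D) are finite and equal. -/

import Mathlib

open MeasureTheory Set

/-- The data of the spatiotemporal matching problem and the standing assumptions on them.
Demand locations lie in `ℝ^d`, demand types in a measure space `(A, ν)`, and there are `n`
stations, indexed by `Fin n`. -/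
structure MatchingModel (d n : ℕ) (A : Type*) [MeasurableSpace A] (ν : Measure A) where
  /-- the spatial domain -/
  X : Set (EuclideanSpace ℝ (Fin d))
  isCompact_X : IsCompact X
  /-- the time horizon, a bounded interval (possibly open, closed or half-open) -/
  T : Set ℝ
  ordConnected_T : T.OrdConnected
  isBounded_T : Bornology.IsBounded T
  /-- the mass function of the demand types -/
  typeMass : A → ℝ
  typeMass_nonneg : ∀ α, 0 ≤ typeMass α
  integrable_typeMass : Integrable typeMass ν
  /-- the density `locDensity α x` of the locations of the demand of type `α` -/
  locDensity : A → EuclideanSpace ℝ (Fin d) → ℝ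
  locDensity_nonneg : ∀ α, ∀ x ∈ X, 0 ≤ locDensity α x
  integrableOn_locDensity : ∀ α, IntegrableOn (locDensity α) X
  integral_locDensity : ∀ α, ∫ x in X, locDensity α x = 1
  /-- the joint demand density is measurable -/
  aestronglyMeasurable_demand :
    AEStronglyMeasurable (fun p : EuclideanSpace ℝ (Fin d) × A => typeMass p.2 * locDensity p.2 p.1)
      ((volume.restrict X).prod ν)
  /-- the positions of the stations -/
  y : Fin n → EuclideanSpace ℝ (Fin d)
  y_mem : ∀ i, y i ∈ X
  /-- the processing capacity `c i t` of station `i` at time `t` -/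
  c : Fin n → ℝ → ℝ
  c_pos : ∀ i, ∀ t ∈ T, 0 < c i t
  integrableOn_c : ∀ i, IntegrableOn (c i) T
  /-- the base reward -/
  r : ℝ
  r_pos : 0 < r
  /-- the transportation cost as a function of the distance -/
  dist_cost : ℝ → ℝ
  dist_cost_zero : dist_cost 0 = 0
  continuousOn_dist_cost : ContinuousOn dist_cost (Ici 0)
  differentiableOn_dist_cost : DifferentiableOn ℝ dist_cost (Ioi 0)
  deriv_dist_cost_pos : ∀ s, 0 < s → 0 < deriv dist_cost s
  convexOn_dist_cost : ConvexOn ℝ (Ici 0) dist_cost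
  /-- the temporal cost `ℓ t α` -/
  ℓ : ℝ → A → ℝ
  ℓ_nonneg : ∀ t ∈ T, ∀ α, 0 ≤ ℓ t α
  integrable_ℓ : Integrable (fun p : ℝ × A => ℓ p.1 p.2) ((volume.restrict T).prod ν)
  continuousOn_ℓ : ∀ α, ContinuousOn (fun t => ℓ t α) T

namespace MatchingModel

variable {d n : ℕ} {A : Type*} [MeasurableSpace A] {ν : Measure A}

/-- The joint demand density `μ(x, α)`. -/
def demand (M : MatchingModel d n A ν) (x : EuclideanSpace ℝ (Fin d)) (α : A) : ℝ :=
  M.typeMass α * M.locDensity α x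

/-- The transportation cost `δ(x, y)`, a function of the Euclidean distance. -/
noncomputable def transportCost (M : MatchingModel d n A ν) (x y : EuclideanSpace ℝ (Fin d)) : ℝ :=
  M.dist_cost ‖x - y‖

/-- The value of serving a unit of demand of type `α` at `x` by station `i` at time `t`. -/
noncomputable def value (M : MatchingModel d n A ν) (i : Fin n) (x : EuclideanSpace ℝ (Fin d)) (α : A) (t : ℝ) :
    ℝ :=
  M.r - M.transportCost x (M.y i) - M.ℓ t α

/-- The reference measure on `X × A`: Lebesgue measure on `X` times `ν`. -/
noncomputable def spaceTypeMeasure (M : MatchingModel d n A ν) :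
    Measure (EuclideanSpace ℝ (Fin d) × A) :=
  (volume.restrict M.X).prod ν

/-- The reference measure on `X × A × T`: Lebesgue measure on `X` and `T`, and `ν` on `A`. -/
noncomputable def planMeasure (M : MatchingModel d n A ν) :
    Measure (EuclideanSpace ℝ (Fin d) × A × ℝ) :=
  (volume.restrict M.X).prod (ν.prod (volume.restrict M.T))

/-- `π` is a feasible matching plan: the `π i` are nonnegative integrable densities on `X × A × T`
that exceed neither the capacity of any station at any time nor the available demand. The two
constraints are inequalities between integrals of nonnegative functions with values in `[0, ∞]`. -/
structure IsPlan (M : MatchingModel d n A ν)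
    (π : Fin n → EuclideanSpace ℝ (Fin d) × A × ℝ → ℝ) : Prop where
  measurable : ∀ i, Measurable (π i)
  nonneg : ∀ i, ∀ x ∈ M.X, ∀ α, ∀ t ∈ M.T, 0 ≤ π i (x, α, t)
  integrable : ∀ i, Integrable (π i) M.planMeasure
  capacity_le : ∀ i, ∀ t ∈ M.T,
    (∫⁻ p, ENNReal.ofReal (π i (p.1, p.2, t)) ∂M.spaceTypeMeasure) ≤ ENNReal.ofReal (M.c i t)
  demand_le : ∀ x ∈ M.X, ∀ α,
    ∑ i, (∫⁻ t in M.T, ENNReal.ofReal (π i (x, α, t))) ≤ ENNReal.ofReal (M.demand x α)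

/-- The values of the primal objective at the feasible plans. As the matching value is at most `r`,
the integral of a plan that fails the integrability condition is `-∞`, so that such a plan does not
contribute to the supremum. -/
def primalValues (M : MatchingModel d n A ν) : Set ℝ :=
  {w | ∃ π : Fin n → EuclideanSpace ℝ (Fin d) × A × ℝ → ℝ, M.IsPlan π ∧
    (∀ i, Integrable (fun p => M.value i p.1 p.2.1 p.2.2 * π i p) M.planMeasure) ∧
    w = ∑ i, (∫ p, M.value i p.1 p.2.1 p.2.2 * π i p ∂M.planMeasure)}

/-- `φ` and `ψ = (φ_i)` are feasible for the dual problem: they are measurable, nonnegative, and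
satisfy the dual constraint at every point of `X × A × T`. -/
structure IsDualFeasible (M : MatchingModel d n A ν)
    (φ : EuclideanSpace ℝ (Fin d) × A → ℝ) (ψ : Fin n → ℝ → ℝ) : Prop where
  measurable_left : Measurable φ
  measurable_right : ∀ i, Measurable (ψ i)
  nonneg_left : ∀ x ∈ M.X, ∀ α, 0 ≤ φ (x, α)
  nonneg_right : ∀ i, ∀ t ∈ M.T, 0 ≤ ψ i t
  value_le : ∀ i, ∀ x ∈ M.X, ∀ α, ∀ t ∈ M.T, M.value i x α t ≤ φ (x, α) + ψ i t

/-- The values of the dual objective at the feasible potentials. The integrals of nonnegative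
potentials that fail the integrability conditions are `+∞`, so that such potentials do not
contribute to the infimum. -/
def dualValues (M : MatchingModel d n A ν) : Set ℝ :=
  {w | ∃ (φ : EuclideanSpace ℝ (Fin d) × A → ℝ) (ψ : Fin n → ℝ → ℝ), M.IsDualFeasible φ ψ ∧
    Integrable (fun p => φ p * M.demand p.1 p.2) M.spaceTypeMeasure ∧
    (∀ i, IntegrableOn (fun t => ψ i t * M.c i t) M.T) ∧
    w = (∫ p, φ p * M.demand p.1 p.2 ∂M.spaceTypeMeasure) +
      ∑ i, (∫ t in M.T, ψ i t * M.c i t)}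

end MatchingModel

/-! Weak duality is Tonelli: integrate the dual constraint against a plan and use the two marginal
constraints. The content is that dual values come arbitrarily close to any upper bound `V` of the
primal values.

Consider plans of the form `π i = f * μ * c i` with `f` bounded. Gluing the time axes of the
stations into one space `Fin n × ℝ`, weighted by the capacities, turns these plans into bounded
densities `f` between two finite measures whose marginals are at most one. Their kernel is the
positive part `v` of the value, which lies between 0 and `r`, since nothing need be carried where
the value is negative.

For this linear program (`BoundsSubcouplings.exists_potentials`), Hahn-Banach is applied in `ℝ × L²
× L²` to the convex cone of attainable triples (value, marginal bounds). The point `(V + ε, 1, 1)`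
is outside its closure: scaling a density down until its marginals are at most one costs at most `r`
times the excess of the marginals, and the excess is controlled by the `L²` distance of the marginal
bounds to 1. Neither compactness nor existence of an optimal plan is needed. The marginal components
of the separating functional are represented by `L²` functions, which become the potentials after
division by the coefficient of the value.

These potentials satisfy the constraint only almost everywhere. They are raised to `r` on null sets,
where the constraint becomes trivial. At the remaining points continuity of the value in `t` is
used: almost every `t` is approximated by a set of positive measure on which the potential is hardly
larger than at `t`. -/

open Filter Topology

/-! ### Bounded densities -/

/-- A measurable function with values in a bounded interval `[0, C]`. -/
structure IsBddDensity {Z : Type*} [MeasurableSpace Z] (f : Z → ℝ) : Prop where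
  measurable : Measurable f
  nonneg : ∀ z, 0 ≤ f z
  bdd : ∃ C, ∀ z, f z ≤ C

namespace IsBddDensity

variable {Z Ω S : Type*} [MeasurableSpace Z] [MeasurableSpace Ω] [MeasurableSpace S]

lemma memLp {f : Z → ℝ} (hf : IsBddDensity f) (μ : Measure Z) [IsFiniteMeasure μ]
    (p : ENNReal) : MemLp f p μ := by
  obtain ⟨C, hC⟩ := hf.bdd
  refine MemLp.of_bound hf.measurable.aestronglyMeasurable C (ae_of_all _ fun z => ?_)
  rw [Real.norm_of_nonneg (hf.nonneg z)]
  exact hC z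

lemma integrable {f : Z → ℝ} (hf : IsBddDensity f) (μ : Measure Z) [IsFiniteMeasure μ] :
    Integrable f μ := memLp_one_iff_integrable.1 (hf.memLp μ 1)

lemma const {c : ℝ} (hc : 0 ≤ c) : IsBddDensity (fun _ : Z => c) :=
  ⟨measurable_const, fun _ => hc, c, fun _ => le_rfl⟩

lemma add {f g : Z → ℝ} (hf : IsBddDensity f) (hg : IsBddDensity g) :
    IsBddDensity (fun z => f z + g z) := by
  obtain ⟨C, hC⟩ := hf.bdd
  obtain ⟨D, hD⟩ := hg.bdd
  exact ⟨hf.measurable.add hg.measurable, fun z => add_nonneg (hf.nonneg z) (hg.nonneg z),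
    C + D, fun z => add_le_add (hC z) (hD z)⟩

lemma mul {f g : Z → ℝ} (hf : IsBddDensity f) (hg : IsBddDensity g) :
    IsBddDensity (fun z => f z * g z) := by
  obtain ⟨C, hC⟩ := hf.bdd
  obtain ⟨D, hD⟩ := hg.bdd
  exact ⟨hf.measurable.mul hg.measurable, fun z => mul_nonneg (hf.nonneg z) (hg.nonneg z),
    C * D, fun z => mul_le_mul (hC z) (hD z) (hg.nonneg z) ((hf.nonneg z).trans (hC z))⟩

lemma comp {f : Z → ℝ} (hf : IsBddDensity f) {g : Ω → Z} (hg : Measurable g) :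
    IsBddDensity (fun ω => f (g ω)) := by
  obtain ⟨C, hC⟩ := hf.bdd
  exact ⟨hf.measurable.comp hg, fun z => hf.nonneg _, C, fun z => hC _⟩

lemma integral_right {f : Ω × S → ℝ} (hf : IsBddDensity f) (τ : Measure S) [IsFiniteMeasure τ] :
    IsBddDensity (fun ω => ∫ s, f (ω, s) ∂τ) := by
  obtain ⟨C, hC⟩ := hf.bdd
  refine ⟨?_, fun ω => integral_nonneg fun s => hf.nonneg _, τ.real univ * C, fun ω => ?_⟩
  · exact (StronglyMeasurable.integral_prod_right (f := fun ω s => f (ω, s))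
      hf.measurable.stronglyMeasurable).measurable
  · refine (integral_mono ((hf.comp measurable_prodMk_left).integrable τ)
      (integrable_const C) fun s => hC _).trans ?_
    simp

lemma integral_left {f : Ω × S → ℝ} (hf : IsBddDensity f) (m : Measure Ω) [IsFiniteMeasure m] :
    IsBddDensity (fun s => ∫ ω, f (ω, s) ∂m) :=
  (hf.comp measurable_swap).integral_right m

lemma inv_max_one {f : Z → ℝ} (hf : IsBddDensity f) :
    IsBddDensity (fun z => (max 1 (f z))⁻¹) :=
  ⟨(measurable_const.max hf.measurable).inv, fun z => by positivity, 1,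
    fun z => inv_le_one_of_one_le₀ (le_max_left _ _)⟩

lemma one_sub {f : Z → ℝ} (hf : IsBddDensity f) (h1 : ∀ z, f z ≤ 1) :
    IsBddDensity (fun z => 1 - f z) :=
  ⟨measurable_const.sub hf.measurable, fun z => sub_nonneg.2 (h1 z), 1,
    fun z => sub_le_self _ (hf.nonneg z)⟩

lemma excess {f : Z → ℝ} (hf : IsBddDensity f) :
    IsBddDensity (fun z => max (f z - 1) 0) := by
  obtain ⟨C, hC⟩ := hf.bdd
  refine ⟨(hf.measurable.sub_const 1).max measurable_const, fun z => le_max_right _ _, C,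
    fun z => max_le (by linarith [hC z]) ((hf.nonneg z).trans (hC z))⟩

end IsBddDensity

/-! ### Scaling densities down to subcouplings -/

section LinearProgram

variable {Ω S : Type*} [MeasurableSpace Ω] [MeasurableSpace S]

/-- `V` bounds the value of every bounded density both of whose marginal densities
are at most one. -/
def BoundsSubcouplings (m : Measure Ω) (τ : Measure S) (v : Ω × S → ℝ) (V : ℝ) : Prop :=
  ∀ f : Ω × S → ℝ, IsBddDensity f → (∀ ω, ∫ s, f (ω, s) ∂τ ≤ 1) → (∀ s, ∫ ω, f (ω, s) ∂m ≤ 1) →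
    ∫ p, v p * f p ∂m.prod τ ≤ V

variable {m : Measure Ω} {τ : Measure S} [IsFiniteMeasure m] [IsFiniteMeasure τ]
  {v : Ω × S → ℝ} {r V : ℝ}

/-- Scaling a marginal `a` by `(max 1 a)⁻¹` removes exactly its excess over one. -/
lemma mul_one_sub_inv_max_one (a : ℝ) : a * (1 - (max 1 a)⁻¹) = max (a - 1) 0 := by
  rcases le_total a 1 with h | h
  · rw [max_eq_left h, max_eq_right (by linarith)]; simp
  · rw [max_eq_right h, max_eq_left (by linarith), mul_sub, mul_inv_cancel₀ (by linarith), mul_one]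

lemma mul_inv_max_one_le (a : ℝ) : a * (max 1 a)⁻¹ ≤ 1 := by
  rw [← div_eq_mul_inv]
  exact div_le_one_of_le₀ (le_max_right _ _) (by positivity)

/-- Scaling a density down to one with marginals at most one loses no more than the
total excess of the marginals, times the bound `r` of the kernel. -/
lemma BoundsSubcouplings.integral_le (hV : BoundsSubcouplings m τ v V) (hv : IsBddDensity v)
    (hvr : ∀ p, v p ≤ r) {f : Ω × S → ℝ} (hf : IsBddDensity f) :
    ∫ p, v p * f p ∂m.prod τ ≤ V + r * ((∫ ω, max ((∫ s, f (ω, s) ∂τ) - 1) 0 ∂m) +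
      ∫ s, max ((∫ ω, f (ω, s) ∂m) - 1) 0 ∂τ) := by
  have hf1 := hf.integral_right τ
  have hf2 := hf.integral_left m
  set f1 : Ω → ℝ := fun ω => ∫ s, f (ω, s) ∂τ with hf1_def
  set f2 : S → ℝ := fun s => ∫ ω, f (ω, s) ∂m with hf2_def
  have hg := hf1.inv_max_one
  have hh := hf2.inv_max_one
  have hg1 : ∀ ω, (max 1 (f1 ω))⁻¹ ≤ 1 := fun ω => inv_le_one_of_one_le₀ (le_max_left _ _)
  have hh1 : ∀ s, (max 1 (f2 s))⁻¹ ≤ 1 := fun s => inv_le_one_of_one_le₀ (le_max_left _ _)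
  set g : Ω → ℝ := fun ω => (max 1 (f1 ω))⁻¹ with hg_def
  set h : S → ℝ := fun s => (max 1 (f2 s))⁻¹ with hh_def
  have hF := (hf.mul (hg.comp measurable_fst)).mul (hh.comp (measurable_snd (α := Ω)))
  have key := hV _ hF (fun ω => ?_) (fun s => ?_)
  · have hA := hf.mul ((hg.one_sub hg1).comp (measurable_fst (β := S)))
    have hB := hf.mul ((hh.one_sub hh1).comp (measurable_snd (α := Ω)))
    have hAi : ∫ p, f p * (1 - g p.1) ∂m.prod τ = ∫ ω, max (f1 ω - 1) 0 ∂m := by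
      rw [integral_prod _ (hA.integrable _)]
      refine integral_congr_ae (ae_of_all _ fun ω => ?_)
      simp only [integral_mul_const]
      exact mul_one_sub_inv_max_one _
    have hBi : ∫ p, f p * (1 - h p.2) ∂m.prod τ = ∫ s, max (f2 s - 1) 0 ∂τ := by
      rw [integral_prod_symm _ (hB.integrable _)]
      refine integral_congr_ae (ae_of_all _ fun s => ?_)
      simp only [integral_mul_const]
      exact mul_one_sub_inv_max_one _
    rw [← hAi, ← hBi, ← integral_add (hA.integrable _) (hB.integrable _), ← integral_const_mul]
    refine le_trans ?_ (add_le_add_left key _)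
    rw [← integral_add ((hv.mul hF).integrable _) (((hA.add hB).integrable _).const_mul r)]
    refine integral_mono ((hv.mul hf).integrable _)
      (((hv.mul hF).integrable _).add (((hA.add hB).integrable _).const_mul r)) fun p => ?_
    have h0 := hf.nonneg p
    have h1 := hv.nonneg p
    have h2 := hvr p
    have h3 := hg1 p.1
    have h4 := hh1 p.2
    have h5 := hg.nonneg p.1
    have h6 := hh.nonneg p.2
    change (max 1 (f1 p.1))⁻¹ ≤ 1 at h3
    simp only at h3 h4 h5 h6 ⊢
    -- With `g`, `h` the two scaling factors, the right side minus the left side is `(r - v) * (f *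
    -- (1 - g) + f * (1 - h)) + v * f * (1 - g) * (1 - h)`.
    have e1 : 0 ≤ f p * (1 - g p.1) := mul_nonneg h0 (sub_nonneg.2 h3)
    have e2 : 0 ≤ f p * (1 - h p.2) := mul_nonneg h0 (sub_nonneg.2 h4)
    have e3 : 0 ≤ (r - v p) * (f p * (1 - g p.1) + f p * (1 - h p.2)) :=
      mul_nonneg (sub_nonneg.2 h2) (add_nonneg e1 e2)
    have e4 : 0 ≤ v p * (f p * (1 - g p.1) * (1 - h p.2)) :=
      mul_nonneg h1 (mul_nonneg e1 (sub_nonneg.2 h4))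
    nlinarith [e3, e4]
  · have : ∀ s, f (ω, s) * g ω * h s ≤ f (ω, s) * g ω := fun s =>
      mul_le_of_le_one_right (mul_nonneg (hf.nonneg _) (hg.nonneg _)) (hh1 s)
    refine (integral_mono ((hF.comp measurable_prodMk_left).integrable τ)
      (((hf.comp measurable_prodMk_left).integrable τ).mul_const (g ω)) this).trans ?_
    rw [integral_mul_const]
    exact mul_inv_max_one_le _
  · have : ∀ ω, f (ω, s) * g ω * h s ≤ f (ω, s) * h s := fun ω =>
      mul_le_mul_of_nonneg_right (mul_le_of_le_one_right (hf.nonneg _) (hg1 ω)) (hh.nonneg s)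
    refine (integral_mono ((hF.comp measurable_prodMk_right).integrable m)
      (((hf.comp measurable_prodMk_right).integrable m).mul_const (h s)) this).trans ?_
    rw [integral_mul_const]
    exact mul_inv_max_one_le _

/-- Almost everywhere the excess is at most `|a - 1|`, whose integral is its inner product with the
constant 1; Cauchy-Schwarz concludes. -/
lemma integral_excess_le {g : Ω → ℝ} (hg : IsBddDensity g) (a : Lp ℝ 2 m) (h : g ≤ᵐ[m] a) :
    ∫ ω, max (g ω - 1) 0 ∂m ≤ ‖a - Lp.const 2 m (1 : ℝ)‖ * ‖Lp.const 2 m (1 : ℝ)‖ := by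
  set o : Lp ℝ 2 m := Lp.const 2 m (1 : ℝ)
  have ho : o =ᵐ[m] fun _ => (1 : ℝ) := Lp.coeFn_const 2 m 1
  rw [← norm_abs_eq_norm (a - o)]
  refine le_trans ?_ (real_inner_le_norm _ _)
  rw [L2.inner_def]
  refine integral_mono_ae (hg.excess.integrable m) (L2.integrable_inner _ _) ?_
  filter_upwards [h, ho, Lp.coeFn_abs (a - o), Lp.coeFn_sub a o] with ω h1 h2 h3 h4
  rw [h3, h4, Pi.sub_apply, h2]
  simp only [RCLike.inner_apply, conj_trivial, one_mul]
  exact max_le ((sub_le_sub_right h1 1).trans (le_abs_self _)) (abs_nonneg _)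

end LinearProgram

/-! ### Separation from the value cone and approximate potentials -/

section LinearProgram

variable {Ω S : Type*} [MeasurableSpace Ω] [MeasurableSpace S]

/-- The cone of triples `(w, a, b)` such that some bounded density has value at least `w` and
marginals at most `a` and `b`. -/
def valueCone (m : Measure Ω) (τ : Measure S) (v : Ω × S → ℝ) :
    Set (ℝ × Lp ℝ 2 m × Lp ℝ 2 τ) :=
  {z | ∃ f : Ω × S → ℝ, IsBddDensity f ∧ z.1 ≤ ∫ p, v p * f p ∂m.prod τ ∧
    (fun ω => ∫ s, f (ω, s) ∂τ) ≤ᵐ[m] z.2.1 ∧ (fun s => ∫ ω, f (ω, s) ∂m) ≤ᵐ[τ] z.2.2}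

variable {m : Measure Ω} {τ : Measure S} [IsFiniteMeasure m] [IsFiniteMeasure τ]
  {v : Ω × S → ℝ} {r V : ℝ}

lemma valueCone_add (hv : IsBddDensity v) {z w : ℝ × Lp ℝ 2 m × Lp ℝ 2 τ}
    (hz : z ∈ valueCone m τ v) (hw : w ∈ valueCone m τ v) : z + w ∈ valueCone m τ v := by
  obtain ⟨f, hf, hf0, hf1, hf2⟩ := hz
  obtain ⟨g, hg, hg0, hg1, hg2⟩ := hw
  refine ⟨fun p => f p + g p, hf.add hg, ?_, ?_, ?_⟩
  · simp only [mul_add]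
    rw [integral_add ((hv.mul hf).integrable _) ((hv.mul hg).integrable _)]
    exact add_le_add hf0 hg0
  · filter_upwards [hf1, hg1, Lp.coeFn_add z.2.1 w.2.1] with ω h1 h2 h3
    rw [Prod.snd_add, Prod.fst_add, h3, integral_add
      ((hf.comp measurable_prodMk_left).integrable τ)
      ((hg.comp measurable_prodMk_left).integrable τ)]
    exact add_le_add h1 h2
  · filter_upwards [hf2, hg2, Lp.coeFn_add z.2.2 w.2.2] with s h1 h2 h3
    rw [Prod.snd_add, Prod.snd_add, h3, integral_add
      ((hf.comp measurable_prodMk_right).integrable m)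
      ((hg.comp measurable_prodMk_right).integrable m)]
    exact add_le_add h1 h2

omit [IsFiniteMeasure m] [IsFiniteMeasure τ] in
lemma valueCone_smul {z : ℝ × Lp ℝ 2 m × Lp ℝ 2 τ}
    (hz : z ∈ valueCone m τ v) {c : ℝ} (hc : 0 ≤ c) : c • z ∈ valueCone m τ v := by
  obtain ⟨f, hf, hf0, hf1, hf2⟩ := hz
  refine ⟨fun p => c * f p, (IsBddDensity.const hc).mul hf, ?_, ?_, ?_⟩
  · simp only [mul_left_comm, integral_const_mul]
    exact mul_le_mul_of_nonneg_left hf0 hc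
  · filter_upwards [hf1, Lp.coeFn_smul c z.2.1] with ω h1 h3
    rw [Prod.smul_snd, Prod.smul_fst, h3, integral_const_mul]
    exact mul_le_mul_of_nonneg_left h1 hc
  · filter_upwards [hf2, Lp.coeFn_smul c z.2.2] with s h1 h3
    rw [Prod.smul_snd, Prod.smul_snd, h3, integral_const_mul]
    exact mul_le_mul_of_nonneg_left h1 hc

lemma convex_valueCone (hv : IsBddDensity v) : Convex ℝ (valueCone m τ v) :=
  fun _ hx _ hy _ _ ha hb _ => valueCone_add hv (valueCone_smul hx ha) (valueCone_smul hy hb)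

-- The zero density gives these triples. They determine the signs of the components of a functional
-- that is nonpositive on the cone.
omit [IsFiniteMeasure m] [IsFiniteMeasure τ] in
lemma mem_valueCone_of_nonneg {w : ℝ} (hw : w ≤ 0) {a : Lp ℝ 2 m} {b : Lp ℝ 2 τ}
    (ha : 0 ≤ᵐ[m] a) (hb : 0 ≤ᵐ[τ] b) : (w, a, b) ∈ valueCone m τ v := by
  refine ⟨fun _ => 0, IsBddDensity.const le_rfl, by simpa using hw, ?_, ?_⟩
  · filter_upwards [ha] with ω h
    simpa using h
  · filter_upwards [hb] with ω h
    simpa using h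

lemma mem_valueCone_of_isBddDensity {f : Ω × S → ℝ} (hf : IsBddDensity f) :
    (∫ p, v p * f p ∂m.prod τ, ((hf.integral_right τ).memLp m 2).toLp,
      ((hf.integral_left m).memLp τ 2).toLp) ∈ valueCone m τ v :=
  ⟨f, hf, le_rfl, ((hf.integral_right τ).memLp m 2).coeFn_toLp.symm.le,
    ((hf.integral_left m).memLp τ 2).coeFn_toLp.symm.le⟩

/-- The cone lies in a closed set, cut out by a bound on the value that is continuous in the
marginal bounds and reduces to `V` when both are 1. -/
lemma BoundsSubcouplings.notMem_closure (hV : BoundsSubcouplings m τ v V) (hv : IsBddDensity v)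
    (hr : 0 ≤ r) (hvr : ∀ p, v p ≤ r) {ε : ℝ} (hε : 0 < ε) :
    (V + ε, Lp.const 2 m (1 : ℝ), Lp.const 2 τ (1 : ℝ)) ∉ closure (valueCone m τ v) := by
  set o₁ := Lp.const 2 m (1 : ℝ)
  set o₂ := Lp.const 2 τ (1 : ℝ)
  have hD : IsClosed {z : ℝ × Lp ℝ 2 m × Lp ℝ 2 τ |
      z.1 ≤ V + r * (‖z.2.1 - o₁‖ * ‖o₁‖ + ‖z.2.2 - o₂‖ * ‖o₂‖)} :=
    isClosed_le continuous_fst (by fun_prop)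
  have hsub : valueCone m τ v ⊆ {z : ℝ × Lp ℝ 2 m × Lp ℝ 2 τ |
      z.1 ≤ V + r * (‖z.2.1 - o₁‖ * ‖o₁‖ + ‖z.2.2 - o₂‖ * ‖o₂‖)} := by
    rintro z ⟨f, hf, hf0, hf1, hf2⟩
    refine (hf0.trans (hV.integral_le hv hvr hf)).trans ?_
    gcongr
    · exact integral_excess_le (hf.integral_right τ) _ hf1
    · exact integral_excess_le (hf.integral_left m) _ hf2
  intro h
  have := closure_minimal hsub hD h
  simp at this
  linarith

omit [IsFiniteMeasure m] [IsFiniteMeasure τ] in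
/-- A closed convex cone is separated from any point outside it by a functional that is
nonpositive on the cone. -/
lemma exists_separating_of_cone {E : Type*} [NormedAddCommGroup E] [NormedSpace ℝ E] {C : Set E}
    (hC : Convex ℝ C) (h0 : (0 : E) ∈ C) (hsmul : ∀ c : ℝ, 0 ≤ c → ∀ z ∈ C, c • z ∈ C) {x : E}
    (hx : x ∉ closure C) : ∃ F : E →L[ℝ] ℝ, (∀ z ∈ C, F z ≤ 0) ∧ 0 < F x := by
  obtain ⟨F, u, hF, hu⟩ := geometric_hahn_banach_closed_point hC.closure isClosed_closure hx
  have hu0 : 0 < u := by simpa using hF 0 (subset_closure h0)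
  refine ⟨F, fun z hz => ?_, hu0.trans hu⟩
  by_contra! hpos
  have := hF _ (subset_closure (hsmul (u / F z) (by positivity) z hz))
  rw [map_smul, smul_eq_mul, div_mul_cancel₀ _ hpos.ne'] at this
  exact this.false

omit [IsFiniteMeasure τ] in
/-- Riesz representation on `L²` of a finite measure, for a functional that is nonnegative on
nonnegative functions. -/
lemma exists_density_of_nonneg (F : Lp ℝ 2 m →L[ℝ] ℝ) (hF : ∀ a : Lp ℝ 2 m, 0 ≤ᵐ[m] a → 0 ≤ F a) :
    ∃ φ : Ω → ℝ, Measurable φ ∧ (∀ ω, 0 ≤ φ ω) ∧ Integrable φ m ∧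
      F (Lp.const 2 m (1 : ℝ)) = ∫ ω, φ ω ∂m ∧
      ∀ g : Ω → ℝ, ∀ hg : IsBddDensity g, F (hg.memLp m 2).toLp = ∫ ω, φ ω * g ω ∂m := by
  set q : Lp ℝ 2 m := (InnerProductSpace.toDual ℝ (Lp ℝ 2 m)).symm F with hq
  have hqF : ∀ a, F a = inner ℝ q a := fun a => (InnerProductSpace.toDual_symm_apply).symm
  have hqi : Integrable q m := (Lp.memLp q).integrable (by norm_num)
  -- Indicators of measurable sets are nonnegative test functions, so the integral of `q` over each
  -- such set is nonnegative.
  have hq0 : 0 ≤ᵐ[m] q := by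
    refine ae_nonneg_of_forall_setIntegral_nonneg hqi fun s hs hms => ?_
    rw [← L2.inner_indicatorConstLp_one (𝕜 := ℝ) hs hms.ne q, real_inner_comm, ← hqF]
    refine hF _ ?_
    filter_upwards [indicatorConstLp_coeFn (p := 2) (hs := hs) (hμs := hms.ne) (c := (1 : ℝ))]
      with ω h
    rw [h]
    exact indicator_nonneg (fun _ _ => zero_le_one) _
  have hqm : AEMeasurable q m := hqi.aemeasurable
  refine ⟨fun ω => max (hqm.mk q ω) 0, hqm.measurable_mk.max measurable_const,
    fun ω => le_max_right _ _, ?_⟩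
  have hae : (fun ω => max (hqm.mk q ω) 0) =ᵐ[m] q := by
    filter_upwards [hq0, hqm.ae_eq_mk] with ω h1 h2
    rw [← h2]
    exact max_eq_left h1
  refine ⟨hqi.congr hae.symm, ?_, fun g hg => ?_⟩
  · rw [hqF, L2.inner_def]
    refine integral_congr_ae ?_
    filter_upwards [hae, Lp.coeFn_const 2 m (1 : ℝ)] with ω h1 h2
    rw [h1, h2]
    simp
  · rw [hqF, L2.inner_def]
    refine integral_congr_ae ?_
    filter_upwards [hae, (hg.memLp m 2).coeFn_toLp] with ω h1 h2
    rw [h1, h2]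
    simp [mul_comm]

/-- Nearly optimal potentials for a transport problem between finite measures with bounded kernel,
with densities as plans. -/
theorem BoundsSubcouplings.exists_potentials (hV : BoundsSubcouplings m τ v V)
    (hv : IsBddDensity v) {ε : ℝ} (hε : 0 < ε) :
    ∃ (φ : Ω → ℝ) (ψ : S → ℝ), Measurable φ ∧ Measurable ψ ∧ (∀ ω, 0 ≤ φ ω) ∧ (∀ s, 0 ≤ ψ s) ∧
      Integrable φ m ∧ Integrable ψ τ ∧ (∀ᵐ p ∂m.prod τ, v p ≤ φ p.1 + ψ p.2) ∧
      (∫ ω, φ ω ∂m) + ∫ s, ψ s ∂τ ≤ V + ε := by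
  obtain ⟨r, hvr⟩ := hv.bdd
  have hV0 : 0 ≤ V := by
    simpa using hV (fun _ => 0) (IsBddDensity.const le_rfl) (by simp) (by simp)
  obtain ⟨F, hF, hF0⟩ := exists_separating_of_cone (convex_valueCone (m := m) (τ := τ) hv)
    (mem_valueCone_of_nonneg le_rfl (Lp.coeFn_zero _ _ _).symm.le (Lp.coeFn_zero _ _ _).symm.le)
    (fun c hc z hz => valueCone_smul hz hc)
    (hV.notMem_closure (r := max r 0) hv (le_max_right _ _)
      (fun p => (hvr p).trans (le_max_left _ _)) hε)
  have hsplit : ∀ w a b, F (w, a, b) = w * F (1, 0, 0) + F (0, a, 0) + F (0, 0, b) := by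
    intro w a b
    rw [← smul_eq_mul, ← map_smul, ← map_add, ← map_add]
    simp
  set l := F (1, 0, 0)
  have hl0 : 0 ≤ l := by
    have h := hF (-1, 0, 0) (mem_valueCone_of_nonneg (by norm_num) (Lp.coeFn_zero _ _ _).symm.le
      (Lp.coeFn_zero _ _ _).symm.le)
    have e : ((-1, 0, 0) : ℝ × Lp ℝ 2 m × Lp ℝ 2 τ) = -(1, 0, 0) := by simp
    rw [e, map_neg] at h
    linarith
  -- `φ` and `ψ` represent minus the two marginal components of `F`: enlarging a marginal bound
  -- stays in the cone, so these components of `F` are nonpositive.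
  obtain ⟨φ, hφm, hφ0, hφi, hφ1, hφ⟩ := exists_density_of_nonneg
    (-(F.comp ((ContinuousLinearMap.inr ℝ ℝ (Lp ℝ 2 m × Lp ℝ 2 τ)).comp
      (ContinuousLinearMap.inl ℝ (Lp ℝ 2 m) (Lp ℝ 2 τ))))) (fun a ha => by
        simpa using hF _ (mem_valueCone_of_nonneg le_rfl ha (Lp.coeFn_zero _ _ _).symm.le))
  obtain ⟨ψ, hψm, hψ0, hψi, hψ1, hψ⟩ := exists_density_of_nonneg
    (-(F.comp ((ContinuousLinearMap.inr ℝ ℝ (Lp ℝ 2 m × Lp ℝ 2 τ)).comp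
      (ContinuousLinearMap.inr ℝ (Lp ℝ 2 m) (Lp ℝ 2 τ))))) (fun a ha => by
        simpa using hF _ (mem_valueCone_of_nonneg le_rfl (Lp.coeFn_zero _ _ _).symm.le ha))
  simp only [neg_apply, ContinuousLinearMap.comp_apply,
    ContinuousLinearMap.inr_apply, ContinuousLinearMap.inl_apply] at hφ1 hφ hψ1 hψ
  rw [hsplit] at hF0
  have hI1 : 0 ≤ ∫ ω, φ ω ∂m := integral_nonneg hφ0
  have hI2 : 0 ≤ ∫ s, ψ s ∂τ := integral_nonneg hψ0
  -- If `l = 0`, then `F` at the separated point would be `-∫ φ - ∫ ψ ≤ 0`.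
  have hl : 0 < l := by
    rcases hl0.eq_or_lt with h | h
    · rw [← h] at hF0; linarith
    · exact h
  refine ⟨fun ω => φ ω / l, fun s => ψ s / l, hφm.div_const l, hψm.div_const l,
    fun ω => div_nonneg (hφ0 ω) hl0, fun s => div_nonneg (hψ0 s) hl0, hφi.div_const l,
    hψi.div_const l, ?_, ?_⟩
  · have hφi' : Integrable (fun p : Ω × S => φ p.1) (m.prod τ) := hφi.comp_fst τ
    have hψi' : Integrable (fun p : Ω × S => ψ p.2) (m.prod τ) := hψi.comp_snd m
    have hG : Integrable (fun p : Ω × S => φ p.1 + ψ p.2 - l * v p) (m.prod τ) :=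
      (hφi'.add hψi').sub ((hv.integrable _).const_mul l)
    -- Each indicator of a measurable subset of the product is an admissible density, and `F ≤ 0` at
    -- its triple says that `φ + ψ - l * v` has nonnegative integral over that subset.
    have hGn : 0 ≤ᵐ[m.prod τ] fun p : Ω × S => φ p.1 + ψ p.2 - l * v p := by
      refine ae_nonneg_of_forall_setIntegral_nonneg hG fun s hs _ => ?_
      have hf : IsBddDensity (s.indicator fun _ => (1 : ℝ)) :=
        ⟨measurable_const.indicator hs, fun z => indicator_nonneg (fun _ _ => zero_le_one) _, 1,
          fun z => indicator_le_self' (fun _ _ => zero_le_one) z⟩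
      have h := hF _ (mem_valueCone_of_isBddDensity (v := v) (m := m) (τ := τ) hf)
      have e1 := hφ _ (hf.integral_right τ)
      have e2 := hψ _ (hf.integral_left m)
      rw [hsplit] at h
      set f := s.indicator fun _ => (1 : ℝ)
      have i1 : Integrable (fun p : Ω × S => φ p.1 * f p) (m.prod τ) := by
        obtain ⟨C, hC⟩ := hf.bdd
        exact hφi'.mul_bdd (c := C) hf.measurable.aestronglyMeasurable
          (ae_of_all _ fun p => by rw [Real.norm_of_nonneg (hf.nonneg p)]; exact hC p)
      have i2 : Integrable (fun p : Ω × S => ψ p.2 * f p) (m.prod τ) := by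
        obtain ⟨C, hC⟩ := hf.bdd
        exact hψi'.mul_bdd (c := C) hf.measurable.aestronglyMeasurable
          (ae_of_all _ fun p => by rw [Real.norm_of_nonneg (hf.nonneg p)]; exact hC p)
      have e3 : ∫ p, φ p.1 * f p ∂m.prod τ = ∫ ω, φ ω * ∫ s, f (ω, s) ∂τ ∂m := by
        rw [integral_prod _ i1]
        simp only [integral_const_mul]
      have e4 : ∫ p, ψ p.2 * f p ∂m.prod τ = ∫ s, ψ s * ∫ ω, f (ω, s) ∂m ∂τ := by
        rw [integral_prod_symm _ i2]
        simp only [integral_const_mul]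
      have e5 : ∫ p in s, (φ p.1 + ψ p.2 - l * v p) ∂m.prod τ =
          ∫ p, (φ p.1 * f p + ψ p.2 * f p - l * (v p * f p)) ∂m.prod τ := by
        rw [← integral_indicator hs]
        refine integral_congr_ae (ae_of_all _ fun p => ?_)
        by_cases hp : p ∈ s <;> simp [f, hp]
      have e6 : ∫ p, (φ p.1 * f p + ψ p.2 * f p) ∂m.prod τ =
          (∫ p, φ p.1 * f p ∂m.prod τ) + ∫ p, ψ p.2 * f p ∂m.prod τ := integral_add i1 i2
      have e7 : Integrable (fun p => φ p.1 * f p + ψ p.2 * f p) (m.prod τ) := i1.add i2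
      rw [e5, integral_sub e7 (((hv.mul hf).integrable _).const_mul l), e6, e3, e4, integral_const_mul, ← e1, ← e2]
      linarith
    filter_upwards [hGn] with p hp
    rw [← add_div, le_div_iff₀ hl]
    simp only [Pi.zero_apply] at hp
    linarith
  -- This is `0 < F (V + ε, 1, 1) = l * (V + ε) - ∫ φ - ∫ ψ`, divided by `l`.
  · rw [integral_div, integral_div, ← add_div, div_le_iff₀ hl]
    linarith

end LinearProgram

/-! ### Modifications on null sets and pointwise inequalities -/

/-- A measurable modification that agrees with the given function or vanishes at each point. -/
lemma AEMeasurable.exists_measurable_eq_or_eq_zero {Z : Type*} [MeasurableSpace Z] {μ : Measure Z}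
    {g : Z → ℝ} (hg : AEMeasurable g μ) {s : Set Z} (hs : ∀ᵐ z ∂μ, z ∈ s) :
    ∃ g' : Z → ℝ, Measurable g' ∧ g' =ᵐ[μ] g ∧ ∀ z, g' z = 0 ∨ (z ∈ s ∧ g' z = g z) := by
  set N := toMeasurable μ {z | ¬ (hg.mk g z = g z ∧ z ∈ s)} with hN
  have hN0 : μ N = 0 := by
    rw [hN, measure_toMeasurable]
    refine measure_eq_zero_iff_ae_notMem.2 ?_
    filter_upwards [hg.ae_eq_mk, hs] with z h1 h2 using not_not.2 ⟨h1.symm, h2⟩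
  have hz : ∀ z, z ∉ N → hg.mk g z = g z ∧ z ∈ s := fun z h => by
    by_contra hc
    exact h (subset_toMeasurable _ _ hc)
  refine ⟨Nᶜ.indicator (hg.mk g), hg.measurable_mk.indicator (measurableSet_toMeasurable _ _).compl,
    ?_, fun z => ?_⟩
  · filter_upwards [measure_eq_zero_iff_ae_notMem.1 hN0] with z h
    rw [indicator_of_mem (mem_compl h), (hz z h).1]
  · by_cases h : z ∈ N
    · left; simp [h]
    · right; exact ⟨(hz z h).2, by rw [indicator_of_mem (mem_compl h), (hz z h).1]⟩

/-- At almost every point `x`, every sublevel set of `g` above `g x` has positive measure near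
`x`. -/
lemma ae_forall_measure_inter_lt_pos {X : Type*} [TopologicalSpace X] [HereditarilyLindelofSpace X]
    [MeasurableSpace X] {μ : Measure X} {g : X → ℝ} (hg : Measurable g) :
    ∀ᵐ x ∂μ, ∀ q : ℝ, g x < q → ∀ U ∈ 𝓝 x, 0 < μ (U ∩ {y | g y < q}) := by
  -- For one level, almost every point of the sublevel set lies in the support of the measure
  -- restricted to it. Rational levels keep the exceptional set null.
  have h : ∀ᵐ x ∂μ, ∀ q : ℚ, g x < q → x ∈ (μ.restrict {y | g y < q}).support := by
    rw [ae_all_iff]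
    intro q
    have hs : MeasurableSet {y | g y < (q : ℝ)} := measurableSet_lt hg measurable_const
    exact (ae_restrict_iff' hs).1 Measure.support_mem_ae
  filter_upwards [h] with x hx q hq U hU
  obtain ⟨q', h1, h2⟩ := exists_rat_btwn hq
  have h3 := (Measure.mem_support_iff_forall x).1 (hx q' h1) U hU
  rw [Measure.restrict_apply' (measurableSet_lt hg measurable_const)] at h3
  exact h3.trans_le (measure_mono (inter_subset_inter_right _ fun y (hy : g y < q') => hy.trans h2))

/-- An almost everywhere inequality with a continuous left side persists at the points
where the right side is approximated from above on sets of positive measure. -/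
lemma le_of_ae_le_of_measure_inter_lt_pos {X : Type*} [TopologicalSpace X] [MeasurableSpace X]
    {μ : Measure X} {T : Set X} (hT : ∀ᵐ x ∂μ, x ∈ T) {g h : X → ℝ} {x : X} (hx : x ∈ T)
    (hh : ContinuousOn h T) (hg : ∀ q : ℝ, g x < q → ∀ U ∈ 𝓝 x, 0 < μ (U ∩ {y | g y < q}))
    (hle : ∀ᵐ y ∂μ, h y ≤ g y) : h x ≤ g x := by
  by_contra! hlt
  obtain ⟨q, h1, h2⟩ := exists_between hlt
  obtain ⟨U, hU, hUT⟩ := mem_nhdsWithin_iff_exists_mem_nhds_inter.1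
    ((hh x hx).eventually_const_lt h2)
  refine (hg q h1 U hU).ne' ?_
  rw [measure_eq_zero_iff_ae_notMem]
  filter_upwards [hT, hle] with y hyT hy hmem
  have h3 : q < h y := hUT ⟨hmem.1, hyT⟩
  have h4 : g y < q := hmem.2
  linarith

/-! ### Measurability and integrability of the model data -/

namespace MatchingModel

variable {d n : ℕ} {A : Type*} [MeasurableSpace A] {ν : Measure A}

section Basic

variable (M : MatchingModel d n A ν)

lemma measurableSet_X : MeasurableSet M.X := M.isCompact_X.measurableSet

lemma measurableSet_T : MeasurableSet M.T := M.ordConnected_T.measurableSet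

lemma dist_cost_nonneg {s : ℝ} (hs : 0 ≤ s) : 0 ≤ M.dist_cost s := by
  have h : StrictMonoOn M.dist_cost (Ici 0) :=
    strictMonoOn_of_deriv_pos (convex_Ici 0) M.continuousOn_dist_cost fun x hx =>
      M.deriv_dist_cost_pos x (by simpa using hx)
  rw [← M.dist_cost_zero]
  exact h.monotoneOn self_mem_Ici hs hs

lemma value_le_r (i : Fin n) (x : EuclideanSpace ℝ (Fin d)) (α : A) {t : ℝ} (ht : t ∈ M.T) :
    M.value i x α t ≤ M.r := by
  have h1 := M.dist_cost_nonneg (norm_nonneg (x - M.y i))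
  have h2 := M.ℓ_nonneg t ht α
  simp only [value, transportCost]
  linarith

lemma continuousOn_value (i : Fin n) (x : EuclideanSpace ℝ (Fin d)) (α : A) :
    ContinuousOn (M.value i x α) M.T :=
  continuousOn_const.sub (M.continuousOn_ℓ α)

lemma continuous_transportCost (y : EuclideanSpace ℝ (Fin d)) :
    Continuous fun x => M.transportCost x y :=
  M.continuousOn_dist_cost.comp_continuous (by fun_prop) fun x => norm_nonneg (x - y)

lemma ae_mem_T : ∀ᵐ t ∂volume.restrict M.T, t ∈ M.T := ae_restrict_mem M.measurableSet_T

lemma ae_fst_mem_X : ∀ᵐ p ∂M.spaceTypeMeasure, p.1 ∈ M.X :=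
  Measure.quasiMeasurePreserving_fst.ae (ae_restrict_mem M.measurableSet_X)

lemma ae_planMeasure_mem : ∀ᵐ p ∂M.planMeasure, p.1 ∈ M.X ∧ p.2.2 ∈ M.T := by
  have h1 : ∀ᵐ p ∂M.planMeasure, p.1 ∈ M.X :=
    Measure.quasiMeasurePreserving_fst.ae (ae_restrict_mem M.measurableSet_X)
  have h2 : ∀ᵐ p ∂M.planMeasure, p.2.2 ∈ M.T :=
    (Measure.quasiMeasurePreserving_snd.comp Measure.quasiMeasurePreserving_snd).ae M.ae_mem_T
  exact h1.and h2

lemma demand_nonneg {x : EuclideanSpace ℝ (Fin d)} (hx : x ∈ M.X) (α : A) : 0 ≤ M.demand x α :=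
  mul_nonneg (M.typeMass_nonneg α) (M.locDensity_nonneg α x hx)

lemma aemeasurable_demand : AEMeasurable (fun p : EuclideanSpace ℝ (Fin d) × A => M.demand p.1 p.2)
    M.spaceTypeMeasure := M.aestronglyMeasurable_demand.aemeasurable

end Basic

variable [SigmaFinite ν] (M : MatchingModel d n A ν)

instance : SFinite M.spaceTypeMeasure := by
  unfold spaceTypeMeasure; infer_instance

lemma measurePreserving_prodAssoc_planMeasure :
    MeasurePreserving MeasurableEquiv.prodAssoc
      (M.spaceTypeMeasure.prod (volume.restrict M.T)) M.planMeasure :=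
  measurePreserving_prodAssoc _ _ _

lemma lintegral_planMeasure {F : EuclideanSpace ℝ (Fin d) × A × ℝ → ENNReal} (hF : Measurable F) :
    ∫⁻ p, F p ∂M.planMeasure =
      ∫⁻ p, (∫⁻ t in M.T, F (p.1, p.2, t)) ∂M.spaceTypeMeasure := by
  rw [← M.measurePreserving_prodAssoc_planMeasure.lintegral_comp hF]
  exact lintegral_prod _ (hF.comp (MeasurableEquiv.measurable _)).aemeasurable

omit [SigmaFinite ν] in
lemma measurable_setLIntegral_T {F : EuclideanSpace ℝ (Fin d) × A × ℝ → ENNReal}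
    (hF : Measurable F) : Measurable fun p : EuclideanSpace ℝ (Fin d) × A =>
      ∫⁻ t in M.T, F (p.1, p.2, t) :=
  (hF.comp MeasurableEquiv.prodAssoc.measurable).lintegral_prod_right'

lemma lintegral_planMeasure_symm {F : EuclideanSpace ℝ (Fin d) × A × ℝ → ENNReal}
    (hF : Measurable F) :
    ∫⁻ p, F p ∂M.planMeasure =
      ∫⁻ t in M.T, ∫⁻ p, F (p.1, p.2, t) ∂M.spaceTypeMeasure := by
  rw [← M.measurePreserving_prodAssoc_planMeasure.lintegral_comp hF]
  exact lintegral_prod_symm _ (hF.comp (MeasurableEquiv.measurable _)).aemeasurable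

/-- Each location density has mass one, so integrating out the location leaves `typeMass`. -/
lemma integrable_demand : Integrable (fun p : EuclideanSpace ℝ (Fin d) × A => M.demand p.1 p.2)
    M.spaceTypeMeasure := by
  refine (integrable_prod_iff' M.aestronglyMeasurable_demand).2
    ⟨ae_of_all _ fun α => (M.integrableOn_locDensity α).const_mul (M.typeMass α), ?_⟩
  refine M.integrable_typeMass.congr (ae_of_all _ fun α => ?_)
  have : ∫ x in M.X, ‖M.typeMass α * M.locDensity α x‖ =
      ∫ x in M.X, M.typeMass α * M.locDensity α x :=
    setIntegral_congr_fun M.measurableSet_X fun x hx =>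
      Real.norm_of_nonneg (M.demand_nonneg hx α)
  simp only
  rw [this, integral_const_mul, M.integral_locDensity, mul_one]

lemma aemeasurable_value (i : Fin n) :
    AEMeasurable (fun p : (EuclideanSpace ℝ (Fin d) × A) × ℝ => M.value i p.1.1 p.1.2 p.2)
      (M.spaceTypeMeasure.prod (volume.restrict M.T)) := by
  have h1 : Measure.QuasiMeasurePreserving
      (fun p : (EuclideanSpace ℝ (Fin d) × A) × ℝ => (p.2, p.1.2))
      (M.spaceTypeMeasure.prod (volume.restrict M.T)) ((volume.restrict M.T).prod ν) :=
    (Measure.measurePreserving_swap.quasiMeasurePreserving.comp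
      Measure.quasiMeasurePreserving_snd).comp
        M.measurePreserving_prodAssoc_planMeasure.quasiMeasurePreserving
  have h2 := M.integrable_ℓ.aemeasurable.comp_quasiMeasurePreserving h1
  have h3 : Measurable fun p : (EuclideanSpace ℝ (Fin d) × A) × ℝ =>
      M.r - M.transportCost p.1.1 (M.y i) :=
    measurable_const.sub ((M.continuous_transportCost _).measurable.comp
      (measurable_fst.comp measurable_fst))
  exact h3.aemeasurable.sub h2

end MatchingModel

/-! ### Weak duality -/

lemma ofReal_integral_le_lintegral_ofReal {Z : Type*} [MeasurableSpace Z] {μ : Measure Z}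
    {f : Z → ℝ} (hf : Integrable f μ) :
    ENNReal.ofReal (∫ z, f z ∂μ) ≤ ∫⁻ z, ENNReal.ofReal (f z) ∂μ := by
  have h : ∫ z, f z ∂μ ≤ ∫ z, max (f z) 0 ∂μ :=
    integral_mono hf hf.pos_part fun z => le_max_left _ _
  refine (ENNReal.ofReal_le_ofReal h).trans ?_
  rw [ofReal_integral_eq_lintegral_ofReal hf.pos_part (ae_of_all _ fun z => le_max_right _ _)]
  simp

namespace MatchingModel

variable {d n : ℕ} {A : Type*} [MeasurableSpace A] {ν : Measure A} [SigmaFinite ν]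
  {M : MatchingModel d n A ν}

lemma IsPlan.sum_lintegral_left_le {π : Fin n → EuclideanSpace ℝ (Fin d) × A × ℝ → ℝ}
    (hπ : M.IsPlan π) {φ : EuclideanSpace ℝ (Fin d) × A → ℝ} (hφ : Measurable φ) :
    ∑ i, ∫⁻ p, ENNReal.ofReal (φ (p.1, p.2.1)) * ENNReal.ofReal (π i p) ∂M.planMeasure ≤
      ∫⁻ p, ENNReal.ofReal (φ p) * ENNReal.ofReal (M.demand p.1 p.2) ∂M.spaceTypeMeasure := by
  have hm : ∀ i, Measurable fun p => ENNReal.ofReal (π i p) := fun i =>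
    (hπ.measurable i).ennreal_ofReal
  have h : ∀ i, ∫⁻ p, ENNReal.ofReal (φ (p.1, p.2.1)) * ENNReal.ofReal (π i p) ∂M.planMeasure =
      ∫⁻ p, ENNReal.ofReal (φ p) * (∫⁻ t in M.T, ENNReal.ofReal (π i (p.1, p.2, t)))
        ∂M.spaceTypeMeasure := fun i => by
    rw [M.lintegral_planMeasure (by have := hm i; fun_prop)]
    refine lintegral_congr fun p => ?_
    exact lintegral_const_mul (ENNReal.ofReal (φ p))
      (f := fun t => ENNReal.ofReal (π i (p.1, p.2, t)))
      ((hm i).comp (by fun_prop : Measurable fun t : ℝ => (p.1, p.2, t)))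
  simp only [h]
  rw [← lintegral_finsetSum]
  · refine lintegral_mono_ae ?_
    filter_upwards [M.ae_fst_mem_X] with p hp
    rw [← Finset.mul_sum]
    gcongr
    exact hπ.demand_le p.1 hp p.2
  · intro i _
    exact hφ.ennreal_ofReal.mul (M.measurable_setLIntegral_T (hm i))

lemma IsPlan.lintegral_right_le {π : Fin n → EuclideanSpace ℝ (Fin d) × A × ℝ → ℝ}
    (hπ : M.IsPlan π) {ψ : ℝ → ℝ} (hψ : Measurable ψ) (i : Fin n) :
    ∫⁻ p, ENNReal.ofReal (ψ p.2.2) * ENNReal.ofReal (π i p) ∂M.planMeasure ≤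
      ∫⁻ t in M.T, ENNReal.ofReal (ψ t) * ENNReal.ofReal (M.c i t) := by
  have hm : Measurable fun p => ENNReal.ofReal (π i p) := (hπ.measurable i).ennreal_ofReal
  rw [M.lintegral_planMeasure_symm (by fun_prop)]
  refine lintegral_mono_ae ?_
  filter_upwards [M.ae_mem_T] with t ht
  refine (lintegral_const_mul _ (hm.comp (by fun_prop))).le.trans ?_
  gcongr
  exact hπ.capacity_le i t ht

/-- The comparison is made in `[0, ∞]`, where the products of potentials and plans can be split and
Tonelli applied before their integrability is known. -/
theorem primalValue_le_dualValue {w w' : ℝ} (hw : w ∈ M.primalValues) (hw' : w' ∈ M.dualValues) :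
    w ≤ w' := by
  obtain ⟨π, hπ, hint, rfl⟩ := hw
  obtain ⟨φ, ψ, hd, hφi, hψi, rfl⟩ := hw'
  have e1 : ENNReal.ofReal (∫ p, φ p * M.demand p.1 p.2 ∂M.spaceTypeMeasure) =
      ∫⁻ p, ENNReal.ofReal (φ p) * ENNReal.ofReal (M.demand p.1 p.2) ∂M.spaceTypeMeasure := by
    rw [ofReal_integral_eq_lintegral_ofReal hφi]
    · refine lintegral_congr_ae ?_
      filter_upwards [M.ae_fst_mem_X] with p hp
      exact ENNReal.ofReal_mul (hd.nonneg_left p.1 hp p.2)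
    · filter_upwards [M.ae_fst_mem_X] with p hp
      exact mul_nonneg (hd.nonneg_left p.1 hp p.2) (M.demand_nonneg hp p.2)
  have e2 : ∀ i, ENNReal.ofReal (∫ t in M.T, ψ i t * M.c i t) =
      ∫⁻ t in M.T, ENNReal.ofReal (ψ i t) * ENNReal.ofReal (M.c i t) := fun i => by
    rw [ofReal_integral_eq_lintegral_ofReal (hψi i)]
    · refine lintegral_congr_ae ?_
      filter_upwards [M.ae_mem_T] with t ht
      exact ENNReal.ofReal_mul (hd.nonneg_right i t ht)
    · filter_upwards [M.ae_mem_T] with t ht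
      exact mul_nonneg (hd.nonneg_right i t ht) (M.c_pos i t ht).le
  have n1 : 0 ≤ ∫ p, φ p * M.demand p.1 p.2 ∂M.spaceTypeMeasure := by
    refine integral_nonneg_of_ae ?_
    filter_upwards [M.ae_fst_mem_X] with p hp
    exact mul_nonneg (hd.nonneg_left p.1 hp p.2) (M.demand_nonneg hp p.2)
  have n2 : ∀ i, 0 ≤ ∫ t in M.T, ψ i t * M.c i t := fun i =>
    setIntegral_nonneg M.measurableSet_T fun t ht =>
      mul_nonneg (hd.nonneg_right i t ht) (M.c_pos i t ht).le
  rw [← ENNReal.ofReal_le_ofReal_iff (add_nonneg n1 (Finset.sum_nonneg fun i _ => n2 i)),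
    ENNReal.ofReal_add n1 (Finset.sum_nonneg fun i _ => n2 i),
    ENNReal.ofReal_sum_of_nonneg fun i _ => n2 i, e1]
  simp only [e2]
  calc ENNReal.ofReal (∑ i, ∫ p, M.value i p.1 p.2.1 p.2.2 * π i p ∂M.planMeasure)
      ≤ ∑ i, ENNReal.ofReal (∫ p, M.value i p.1 p.2.1 p.2.2 * π i p ∂M.planMeasure) :=
        Finset.le_sum_of_subadditive _ ENNReal.ofReal_zero.le (fun _ _ => ENNReal.ofReal_add_le) _ _
    _ ≤ ∑ i, ∫⁻ p, (ENNReal.ofReal (φ (p.1, p.2.1)) * ENNReal.ofReal (π i p) +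
          ENNReal.ofReal (ψ i p.2.2) * ENNReal.ofReal (π i p)) ∂M.planMeasure := by
        gcongr with i
        refine (ofReal_integral_le_lintegral_ofReal (hint i)).trans (lintegral_mono_ae ?_)
        filter_upwards [M.ae_planMeasure_mem] with p hp
        have h0 := hπ.nonneg i p.1 hp.1 p.2.1 p.2.2 hp.2
        rw [← add_mul, ← ENNReal.ofReal_add (hd.nonneg_left _ hp.1 _) (hd.nonneg_right i _ hp.2),
          ← ENNReal.ofReal_mul' h0]
        gcongr
        exact hd.value_le i _ hp.1 _ _ hp.2
    _ = (∑ i, ∫⁻ p, ENNReal.ofReal (φ (p.1, p.2.1)) * ENNReal.ofReal (π i p) ∂M.planMeasure) +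
          ∑ i, ∫⁻ p, ENNReal.ofReal (ψ i p.2.2) * ENNReal.ofReal (π i p) ∂M.planMeasure := by
        rw [← Finset.sum_add_distrib]
        refine Finset.sum_congr rfl fun i _ => lintegral_add_left ?_ _
        have := hd.measurable_left
        have := hπ.measurable i
        fun_prop
    _ ≤ _ := add_le_add (hπ.sum_lintegral_left_le hd.measurable_left)
        (Finset.sum_le_sum fun i _ => hπ.lintegral_right_le (hd.measurable_right i) i)

end MatchingModel

/-! ### Weighted measures and their disjoint sums -/

section Density

variable {Z : Type*} [MeasurableSpace Z] {μ : Measure Z} {f g : Z → ℝ}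

lemma integrable_withDensity_ofReal_iff (hf : Measurable f) (hf0 : ∀ z, 0 ≤ f z) :
    Integrable g (μ.withDensity fun z => ENNReal.ofReal (f z)) ↔
      Integrable (fun z => g z * f z) μ := by
  rw [integrable_withDensity_iff_integrable_smul' hf.ennreal_ofReal
    (ae_of_all _ fun z => ENNReal.ofReal_lt_top)]
  simp only [ENNReal.toReal_ofReal (hf0 _), smul_eq_mul, mul_comm]

lemma integral_withDensity_ofReal (hf : Measurable f) (hf0 : ∀ z, 0 ≤ f z) :
    ∫ z, g z ∂μ.withDensity (fun z => ENNReal.ofReal (f z)) = ∫ z, g z * f z ∂μ := by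
  rw [integral_withDensity_eq_integral_toReal_smul hf.ennreal_ofReal
    (ae_of_all _ fun z => ENNReal.ofReal_lt_top)]
  simp only [ENNReal.toReal_ofReal (hf0 _), smul_eq_mul, mul_comm]

lemma lintegral_withDensity_ofReal (hf : Measurable f) {h : Z → ENNReal} (hh : Measurable h) :
    ∫⁻ z, h z ∂μ.withDensity (fun z => ENNReal.ofReal (f z)) =
      ∫⁻ z, h z * ENNReal.ofReal (f z) ∂μ := by
  rw [lintegral_withDensity_eq_lintegral_mul _ hf.ennreal_ofReal hh]
  simp only [Pi.mul_apply, mul_comm]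

end Density

/-- The sum over `i` of the measures with density `c i` on the copies `{i} × Z` of `Z`. -/
noncomputable def disjointDensity {ι Z : Type*} [Fintype ι] [MeasurableSpace ι] [MeasurableSpace Z]
    (μ : Measure Z) (c : ι → Z → ℝ) : Measure (ι × Z) :=
  ∑ i, (μ.withDensity fun z => ENNReal.ofReal (c i z)).map (Prod.mk i)

section DisjointDensity

variable {ι Z : Type*} [Fintype ι] [MeasurableSpace ι] [MeasurableSpace Z] {μ : Measure Z}
  {c : ι → Z → ℝ}

lemma isFiniteMeasure_disjointDensity (hc : ∀ i, Integrable (c i) μ) :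
    IsFiniteMeasure (disjointDensity μ c) := by
  have := fun i => isFiniteMeasure_withDensity_ofReal (hc i).2
  unfold disjointDensity
  infer_instance

lemma lintegral_disjointDensity (hc : ∀ i, Measurable (c i)) {h : ι × Z → ENNReal}
    (hh : Measurable h) :
    ∫⁻ s, h s ∂disjointDensity μ c = ∑ i, ∫⁻ z, h (i, z) * ENNReal.ofReal (c i z) ∂μ := by
  unfold disjointDensity
  rw [lintegral_finsetSum_measure]
  refine Finset.sum_congr rfl fun i _ => ?_
  rw [lintegral_map hh measurable_prodMk_left,
    lintegral_withDensity_ofReal (h := fun z => h (i, z)) (hc i)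
      (hh.comp measurable_prodMk_left)]

/-- A density does not see the points where it vanishes; strictly positive capacities will make the
restriction `0 < c i z` harmless. -/
lemma ae_of_ae_disjointDensity (hc : ∀ i, Measurable (c i)) {P : ι × Z → Prop}
    (h : ∀ᵐ s ∂disjointDensity μ c, P s) (i : ι) : ∀ᵐ z ∂μ, 0 < c i z → P (i, z) := by
  have h1 : ∀ᵐ s ∂(μ.withDensity fun z => ENNReal.ofReal (c i z)).map (Prod.mk i), P s :=
    ae_mono (Finset.single_le_sum (f := fun i =>
      (μ.withDensity fun z => ENNReal.ofReal (c i z)).map (Prod.mk i))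
      (fun _ _ => Measure.zero_le _) (Finset.mem_univ i)) h
  have h2 := ae_of_ae_map measurable_prodMk_left.aemeasurable h1
  rw [ae_withDensity_iff (hc i).ennreal_ofReal] at h2
  filter_upwards [h2] with z hz h0
  exact hz (ENNReal.ofReal_pos.2 h0).ne'

lemma integrable_of_integrable_disjointDensity (hc : ∀ i, Measurable (c i)) (hc0 : ∀ i z, 0 ≤ c i z)
    {ψ : ι × Z → ℝ} (hψm : Measurable ψ) (hψ : Integrable ψ (disjointDensity μ c)) (i : ι) :
    Integrable (fun z => ψ (i, z) * c i z) μ := by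
  have h := integrable_finsetSum_measure.1 hψ i (Finset.mem_univ i)
  rw [integrable_map_measure hψm.aestronglyMeasurable measurable_prodMk_left.aemeasurable] at h
  exact (integrable_withDensity_ofReal_iff (hc i) (hc0 i)).1 h

lemma integral_disjointDensity (hc : ∀ i, Measurable (c i)) (hc0 : ∀ i z, 0 ≤ c i z)
    {ψ : ι × Z → ℝ} (hψm : Measurable ψ) (hψ : Integrable ψ (disjointDensity μ c)) :
    ∫ s, ψ s ∂disjointDensity μ c = ∑ i, ∫ z, ψ (i, z) * c i z ∂μ := by
  have h := integrable_finsetSum_measure.1 hψ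
  unfold disjointDensity
  rw [integral_finsetSum_measure h]
  refine Finset.sum_congr rfl fun i _ => ?_
  rw [integral_map measurable_prodMk_left.aemeasurable hψm.aestronglyMeasurable]
  exact integral_withDensity_ofReal (hc i) (hc0 i)

end DisjointDensity

/-! ### Plans from bounded densities -/

namespace MatchingModel

variable {d n : ℕ} {A : Type*} [MeasurableSpace A] {ν : Measure A} [SigmaFinite ν]
  {M : MatchingModel d n A ν}

/-- The plan with density `f` relative to the demand density `μ'` and the capacities `c'`, carried
by the set where `v` is positive. -/
noncomputable def planOfDensity (μ' : EuclideanSpace ℝ (Fin d) × A → ℝ) (c' : Fin n → ℝ → ℝ)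
    (v f : (EuclideanSpace ℝ (Fin d) × A) × (Fin n × ℝ) → ℝ) (i : Fin n) :
    EuclideanSpace ℝ (Fin d) × A × ℝ → ℝ :=
  {q | 0 < v ((q.1, q.2.1), (i, q.2.2))}.indicator fun q =>
    f ((q.1, q.2.1), (i, q.2.2)) * μ' (q.1, q.2.1) * c' i q.2.2

section PlanOfDensity

variable {μ' : EuclideanSpace ℝ (Fin d) × A → ℝ} {c' : Fin n → ℝ → ℝ}
  {v f : (EuclideanSpace ℝ (Fin d) × A) × (Fin n × ℝ) → ℝ}

lemma measurable_planOfDensity (hμm : Measurable μ') (hcm : ∀ i, Measurable (c' i))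
    (hv : IsBddDensity v) (hf : IsBddDensity f) (i : Fin n) :
    Measurable (planOfDensity μ' c' v f i) := by
  have h := hcm i
  have h1 := hv.measurable
  have h2 := hf.measurable
  refine Measurable.indicator (by fun_prop) (measurableSet_lt measurable_const (by fun_prop))

lemma planOfDensity_nonneg (hμ0 : ∀ p, 0 ≤ μ' p) (hc0 : ∀ i t, 0 ≤ c' i t)
    (hf : IsBddDensity f) (i : Fin n) (q) : 0 ≤ planOfDensity μ' c' v f i q :=
  indicator_nonneg (fun _ _ => mul_nonneg (mul_nonneg (hf.nonneg _) (hμ0 _)) (hc0 _ _)) q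

lemma ofReal_planOfDensity_le (hμ0 : ∀ p, 0 ≤ μ' p) (hc0 : ∀ i t, 0 ≤ c' i t)
    (hf : IsBddDensity f) (i : Fin n) (q) : ENNReal.ofReal (planOfDensity μ' c' v f i q) ≤
      ENNReal.ofReal (f ((q.1, q.2.1), (i, q.2.2))) * ENNReal.ofReal (μ' (q.1, q.2.1)) *
        ENNReal.ofReal (c' i q.2.2) := by
  rw [← ENNReal.ofReal_mul (hf.nonneg _), ← ENNReal.ofReal_mul' (hc0 _ _)]
  refine ENNReal.ofReal_le_ofReal (indicator_le_self' (fun _ _ => ?_) q)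
  exact mul_nonneg (mul_nonneg (hf.nonneg _) (hμ0 _)) (hc0 _ _)

lemma sum_lintegral_planOfDensity_le {lam : Measure ℝ} (hμ0 : ∀ p, 0 ≤ μ' p)
    (hcm : ∀ i, Measurable (c' i)) (hc0 : ∀ i t, 0 ≤ c' i t) (hci : ∀ i, Integrable (c' i) lam)
    (hf : IsBddDensity f) (hf1 : ∀ ω, ∫ s, f (ω, s) ∂disjointDensity lam c' ≤ 1)
    (p : EuclideanSpace ℝ (Fin d) × A) :
    ∑ i, ∫⁻ t, ENNReal.ofReal (planOfDensity μ' c' v f i (p.1, p.2, t)) ∂lam ≤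
      ENNReal.ofReal (μ' p) := by
  have := isFiniteMeasure_disjointDensity hci
  have hfp := hf.comp (measurable_prodMk_left (x := p))
  have h1 : ∑ i, ∫⁻ t, ENNReal.ofReal (f (p, (i, t))) * ENNReal.ofReal (c' i t) ∂lam ≤ 1 := by
    rw [← lintegral_disjointDensity hcm hfp.measurable.ennreal_ofReal,
      ← ofReal_integral_eq_lintegral_ofReal (hfp.integrable _) (ae_of_all _ hfp.nonneg)]
    exact ENNReal.ofReal_le_one.2 (hf1 p)
  calc _ ≤ ∑ i, ∫⁻ t, ENNReal.ofReal (μ' p) *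
          (ENNReal.ofReal (f (p, (i, t))) * ENNReal.ofReal (c' i t)) ∂lam := by
        gcongr with i _ t
        refine (ofReal_planOfDensity_le hμ0 hc0 hf i _).trans (le_of_eq ?_)
        simp only [Prod.mk.eta]
        ring
    _ = ENNReal.ofReal (μ' p) * ∑ i,
          ∫⁻ t, ENNReal.ofReal (f (p, (i, t))) * ENNReal.ofReal (c' i t) ∂lam := by
        rw [Finset.mul_sum]
        refine Finset.sum_congr rfl fun i _ => lintegral_const_mul' _ _ ENNReal.ofReal_ne_top
    _ ≤ ENNReal.ofReal (μ' p) * 1 := by gcongr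
    _ = _ := mul_one _

lemma lintegral_planOfDensity_le {κ : Measure (EuclideanSpace ℝ (Fin d) × A)}
    (hμm : Measurable μ') (hμ0 : ∀ p, 0 ≤ μ' p) (hμi : Integrable μ' κ)
    (hc0 : ∀ i t, 0 ≤ c' i t) (hf : IsBddDensity f)
    (hf2 : ∀ s, ∫ p, f (p, s) ∂κ.withDensity (fun p => ENNReal.ofReal (μ' p)) ≤ 1)
    (i : Fin n) (t : ℝ) :
    ∫⁻ p, ENNReal.ofReal (planOfDensity μ' c' v f i (p.1, p.2, t)) ∂κ ≤
      ENNReal.ofReal (c' i t) := by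
  have := isFiniteMeasure_withDensity_ofReal hμi.2
  have hft := hf.comp (measurable_prodMk_right (y := (i, t)))
  have h1 : ∫⁻ p, ENNReal.ofReal (f (p, (i, t))) * ENNReal.ofReal (μ' p) ∂κ ≤ 1 := by
    rw [← lintegral_withDensity_ofReal hμm hft.measurable.ennreal_ofReal,
      ← ofReal_integral_eq_lintegral_ofReal (hft.integrable _) (ae_of_all _ hft.nonneg)]
    exact ENNReal.ofReal_le_one.2 (hf2 (i, t))
  calc _ ≤ ∫⁻ p, ENNReal.ofReal (f (p, (i, t))) * ENNReal.ofReal (μ' p) *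
          ENNReal.ofReal (c' i t) ∂κ :=
        lintegral_mono fun p => ofReal_planOfDensity_le hμ0 hc0 hf i _
    _ = (∫⁻ p, ENNReal.ofReal (f (p, (i, t))) * ENNReal.ofReal (μ' p) ∂κ) *
          ENNReal.ofReal (c' i t) := lintegral_mul_const' _ _ ENNReal.ofReal_ne_top
    _ ≤ 1 * ENNReal.ofReal (c' i t) := by gcongr
    _ = _ := one_mul _

/-- An upper bound for the primal values bounds the densities relative to the demand and
the capacities. -/
lemma boundsSubcouplings_of_mem_upperBounds {V : ℝ} (hV : V ∈ upperBounds M.primalValues)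
    (hμm : Measurable μ') (hμ0 : ∀ p, 0 ≤ μ' p) (hμi : Integrable μ' M.spaceTypeMeasure)
    (hμle : ∀ p, p.1 ∈ M.X → μ' p ≤ M.demand p.1 p.2)
    (hcm : ∀ i, Measurable (c' i)) (hc0 : ∀ i t, 0 ≤ c' i t)
    (hci : ∀ i, Integrable (c' i) (volume.restrict M.T)) (hcle : ∀ i, ∀ t ∈ M.T, c' i t ≤ M.c i t)
    (hv : IsBddDensity v)
    (hvv : ∀ p i t, v (p, (i, t)) = 0 ∨ v (p, (i, t)) = M.value i p.1 p.2 t) :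
    BoundsSubcouplings (M.spaceTypeMeasure.withDensity fun p => ENNReal.ofReal (μ' p))
      (disjointDensity (volume.restrict M.T) c') v V := by
  intro f hf hf1 hf2
  have := isFiniteMeasure_disjointDensity hci
  have := isFiniteMeasure_withDensity_ofReal hμi.2
  set π := planOfDensity μ' c' v f with hπ_def
  have hπm := measurable_planOfDensity hμm hcm hv hf
  have hπ0 := planOfDensity_nonneg (v := v) hμ0 hc0 hf
  have hπ1 := sum_lintegral_planOfDensity_le (v := v) hμ0 hcm hc0 hci hf hf1
  have hπi : ∀ i, Integrable (π i) M.planMeasure := fun i => by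
    refine ⟨(hπm i).aestronglyMeasurable, ?_⟩
    rw [hasFiniteIntegral_iff_ofReal (ae_of_all _ (hπ0 i)),
      M.lintegral_planMeasure (hπm i).ennreal_ofReal]
    refine lt_of_le_of_lt (lintegral_mono fun p => ?_)
      ((hasFiniteIntegral_iff_ofReal (ae_of_all _ hμ0)).1 hμi.2)
    exact (Finset.single_le_sum (f := fun i => ∫⁻ t in M.T, ENNReal.ofReal (π i (p.1, p.2, t)))
      (fun _ _ => zero_le) (Finset.mem_univ i)).trans (hπ1 p)
  have hplan : M.IsPlan π :=
    { measurable := hπm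
      nonneg := fun i x _ α t _ => hπ0 i _
      integrable := hπi
      capacity_le := fun i t ht => (lintegral_planOfDensity_le hμm hμ0 hμi hc0 hf hf2 i t).trans
        (ENNReal.ofReal_le_ofReal (hcle i t ht))
      demand_le := fun x hx α => (hπ1 (x, α)).trans (ENNReal.ofReal_le_ofReal (hμle (x, α) hx)) }
  -- Where `v` vanishes the value may be negative; the plan is zero there by construction, so value
  -- and `v` agree against it.
  have hG : ∀ i q, M.value i q.1 q.2.1 q.2.2 * π i q = v ((q.1, q.2.1), (i, q.2.2)) * π i q := by
    intro i q
    rcases hvv (q.1, q.2.1) i q.2.2 with h | h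
    · have : π i q = 0 := indicator_of_notMem (by simp [h]) _
      simp [this]
    · rw [h]
  have hG' : ∀ i q, v ((q.1, q.2.1), (i, q.2.2)) * π i q =
      v ((q.1, q.2.1), (i, q.2.2)) * f ((q.1, q.2.1), (i, q.2.2)) * c' i q.2.2 *
        μ' (q.1, q.2.1) := by
    intro i q
    rcases (hv.nonneg ((q.1, q.2.1), (i, q.2.2))).eq_or_lt with h | h
    · simp [← h]
    · have : π i q = f ((q.1, q.2.1), (i, q.2.2)) * μ' (q.1, q.2.1) * c' i q.2.2 :=
        indicator_of_mem (s := {q : EuclideanSpace ℝ (Fin d) × A × ℝ |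
          0 < v ((q.1, q.2.1), (i, q.2.2))}) h _
      rw [this]
      ring
  have hGi : ∀ i, Integrable (fun q => M.value i q.1 q.2.1 q.2.2 * π i q) M.planMeasure :=
    fun i => by
    simp only [hG]
    obtain ⟨C, hC⟩ := hv.bdd
    refine (hπi i).bdd_mul (c := C) ?_ (ae_of_all _ fun q => ?_)
    · exact (hv.measurable.comp (by fun_prop)).aestronglyMeasurable
    · rw [Real.norm_of_nonneg (hv.nonneg _)]
      exact hC _
  have hle := hV ⟨π, hplan, hGi, rfl⟩
  refine le_trans (le_of_eq ?_) hle
  have hvf := hv.mul hf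
  have hGn : ∀ i q, 0 ≤ M.value i q.1 q.2.1 q.2.2 * π i q := fun i q => by
    rw [hG]
    exact mul_nonneg (hv.nonneg _) (hπ0 i q)
  have hGm : ∀ i, Measurable fun q : EuclideanSpace ℝ (Fin d) × A × ℝ =>
      ENNReal.ofReal (M.value i q.1 q.2.1 q.2.2 * π i q) := fun i => by
    simp only [hG]
    exact ((hv.measurable.comp (by fun_prop)).mul (hπm i)).ennreal_ofReal
  -- Both integrands are nonnegative, so the two objectives can be compared as iterated lower
  -- integrals.
  rw [← ENNReal.ofReal_eq_ofReal_iff (integral_nonneg hvf.nonneg)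
    (Finset.sum_nonneg fun i _ => integral_nonneg (hGn i)),
    ENNReal.ofReal_sum_of_nonneg fun i _ => integral_nonneg (hGn i),
    ofReal_integral_eq_lintegral_ofReal (hvf.integrable _) (ae_of_all _ hvf.nonneg),
    lintegral_prod _ hvf.measurable.ennreal_ofReal.aemeasurable]
  have hm := hvf.measurable.ennreal_ofReal
  rw [lintegral_withDensity_ofReal hμm hm.lintegral_prod_right']
  have h1 : ∀ i, ENNReal.ofReal (∫ q, M.value i q.1 q.2.1 q.2.2 * π i q ∂M.planMeasure) =
      ∫⁻ p, (∫⁻ t in M.T, ENNReal.ofReal (M.value i p.1 p.2 t * π i (p.1, p.2, t)))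
        ∂M.spaceTypeMeasure := fun i => by
    rw [ofReal_integral_eq_lintegral_ofReal (hGi i) (ae_of_all _ (hGn i)),
      M.lintegral_planMeasure (hGm i)]
  simp only [h1]
  rw [← lintegral_finsetSum]
  · refine lintegral_congr fun p => ?_
    rw [lintegral_disjointDensity hcm (h := fun s => ENNReal.ofReal (v (p, s) * f (p, s)))
      (hm.comp measurable_prodMk_left), Finset.sum_mul]
    refine Finset.sum_congr rfl fun i _ => ?_
    rw [← lintegral_mul_const' _ _ ENNReal.ofReal_ne_top]
    refine lintegral_congr fun t => ?_
    have e := hG i (p.1, p.2, t)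
    simp only at e
    rw [e, hG' i (p.1, p.2, t), ← ENNReal.ofReal_mul (hvf.nonneg _),
      ← ENNReal.ofReal_mul' (hμ0 _)]
  · intro i _
    exact M.measurable_setLIntegral_T (hGm i)

end PlanOfDensity

end MatchingModel

/-! ### From almost everywhere potentials to dual values -/

namespace MatchingModel

variable {d n : ℕ} {A : Type*} [MeasurableSpace A] {ν : Measure A}

/-- Potentials satisfying the dual constraint almost everywhere can be modified on null sets
so as to satisfy it everywhere. -/
lemma exists_isDualFeasible_of_ae (M : MatchingModel d n A ν)
    {m : Measure (EuclideanSpace ℝ (Fin d) × A)} {φ : EuclideanSpace ℝ (Fin d) × A → ℝ}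
    {ψ : Fin n → ℝ → ℝ} (hφm : Measurable φ) (hψm : ∀ i, Measurable (ψ i)) (hφ0 : ∀ p, 0 ≤ φ p)
    (hψ0 : ∀ i t, 0 ≤ ψ i t)
    (h : ∀ᵐ p ∂m, ∀ i, ∀ᵐ t ∂volume.restrict M.T, M.value i p.1 p.2 t ≤ φ p + ψ i t) :
    ∃ φ' ψ', M.IsDualFeasible φ' ψ' ∧ φ' =ᵐ[m] φ ∧ ∀ i, ψ' i =ᵐ[volume.restrict M.T] ψ i := by
  classical
  -- `P` collects the points whose constraint holds for almost every time, `Q i` the times at which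
  -- `ψ i` is approximated from above on sets of positive measure. Their complements are null, and
  -- so are the measurable hulls of these complements.
  set P : Set (EuclideanSpace ℝ (Fin d) × A) :=
    {p | ∀ i, ∀ᵐ t ∂volume.restrict M.T, M.value i p.1 p.2 t ≤ φ p + ψ i t}
  set Q : Fin n → Set ℝ := fun i => {t | ∀ q : ℝ, ψ i t < q → ∀ U ∈ 𝓝 t,
    0 < volume.restrict M.T (U ∩ {s | ψ i s < q})}
  have hN : m (toMeasurable m Pᶜ) = 0 := by rwa [measure_toMeasurable]
  have hR : ∀ i, volume.restrict M.T (toMeasurable (volume.restrict M.T) (Q i)ᶜ) = 0 := fun i => by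
    rw [measure_toMeasurable]
    exact ae_forall_measure_inter_lt_pos (hψm i)
  have hNm := measurableSet_toMeasurable m Pᶜ
  have hRm := fun i => measurableSet_toMeasurable (volume.restrict M.T) (Q i)ᶜ
  have hPN : ∀ p, p ∉ toMeasurable m Pᶜ → p ∈ P := fun p hp => by
    by_contra hc
    exact hp (subset_toMeasurable _ _ hc)
  have hQR : ∀ i t, t ∉ toMeasurable (volume.restrict M.T) (Q i)ᶜ → t ∈ Q i := fun i t ht => by
    by_contra hc
    exact ht (subset_toMeasurable _ _ hc)
  set N := toMeasurable m Pᶜ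
  set R := fun i => toMeasurable (volume.restrict M.T) (Q i)ᶜ
  have hφ'0 : ∀ p, 0 ≤ N.piecewise (fun _ => M.r) φ p := fun p => by
    by_cases hp : p ∈ N
    · simpa [hp] using M.r_pos.le
    · simpa [hp] using hφ0 p
  have hψ'0 : ∀ i t, 0 ≤ (R i).piecewise (fun _ => M.r) (ψ i) t := fun i t => by
    by_cases ht : t ∈ R i
    · simpa [ht] using M.r_pos.le
    · simpa [ht] using hψ0 i t
  -- The value never exceeds `M.r`, so raising either potential to `M.r` settles the constraint at
  -- the exceptional points.
  refine ⟨N.piecewise (fun _ => M.r) φ, fun i => (R i).piecewise (fun _ => M.r) (ψ i),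
    ⟨measurable_const.piecewise hNm hφm, fun i => measurable_const.piecewise (hRm i) (hψm i),
      fun x _ α => hφ'0 _, fun i t _ => hψ'0 i t, fun i x _ α t ht => ?_⟩, ?_, fun i => ?_⟩
  · have hr := M.value_le_r i x α ht
    by_cases hp : (x, α) ∈ N
    · rw [piecewise_eq_of_mem _ _ _ hp]
      linarith [hψ'0 i t]
    by_cases htR : t ∈ R i
    · rw [piecewise_eq_of_mem _ _ _ htR]
      linarith [hφ'0 (x, α)]
    rw [piecewise_eq_of_notMem _ _ _ hp, piecewise_eq_of_notMem _ _ _ htR]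
    have := le_of_ae_le_of_measure_inter_lt_pos M.ae_mem_T (g := ψ i)
      (h := fun t => M.value i x α t - φ (x, α)) ht
      ((M.continuousOn_value i x α).sub continuousOn_const) (hQR i t htR)
      (by filter_upwards [hPN _ hp i] with s hs using by linarith)
    linarith
  · filter_upwards [measure_eq_zero_iff_ae_notMem.1 hN] with p hp
    exact piecewise_eq_of_notMem _ _ _ hp
  · filter_upwards [measure_eq_zero_iff_ae_notMem.1 (hR i)] with t ht
    exact piecewise_eq_of_notMem _ _ _ ht

/-- Potentials that satisfy the dual constraint almost everywhere yield a dual value. -/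
lemma integral_add_integral_mem_dualValues (M : MatchingModel d n A ν)
    {μ' : EuclideanSpace ℝ (Fin d) × A → ℝ} {c' : Fin n → ℝ → ℝ} (hμm : Measurable μ')
    (hμ0 : ∀ p, 0 ≤ μ' p)
    (hμae : μ' =ᵐ[M.spaceTypeMeasure] fun p => M.demand p.1 p.2)
    (hcm : ∀ i, Measurable (c' i)) (hc0 : ∀ i t, 0 ≤ c' i t)
    (hcae : ∀ i, c' i =ᵐ[volume.restrict M.T] M.c i)
    {φ : EuclideanSpace ℝ (Fin d) × A → ℝ} {ψ : Fin n × ℝ → ℝ} (hφm : Measurable φ)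
    (hψm : Measurable ψ) (hφ0 : ∀ p, 0 ≤ φ p) (hψ0 : ∀ s, 0 ≤ ψ s)
    (hφi : Integrable φ (M.spaceTypeMeasure.withDensity fun p => ENNReal.ofReal (μ' p)))
    (hψi : Integrable ψ (disjointDensity (volume.restrict M.T) c'))
    (hae : ∀ᵐ p ∂M.spaceTypeMeasure.withDensity fun p => ENNReal.ofReal (μ' p), ∀ i,
      ∀ᵐ t ∂volume.restrict M.T, M.value i p.1 p.2 t ≤ φ p + ψ (i, t)) :
    (∫ p, φ p ∂M.spaceTypeMeasure.withDensity fun p => ENNReal.ofReal (μ' p)) +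
      ∫ s, ψ s ∂disjointDensity (volume.restrict M.T) c' ∈ M.dualValues := by
  obtain ⟨φ', ψ', hfeas, hφ', hψ'⟩ := M.exists_isDualFeasible_of_ae hφm
    (ψ := fun i t => ψ (i, t)) (fun i => hψm.comp measurable_prodMk_left) hφ0
    (fun i t => hψ0 _) hae
  have hφμ : (fun p => φ' p * μ' p) =ᵐ[M.spaceTypeMeasure]
      fun p => φ' p * M.demand p.1 p.2 := by
    filter_upwards [hμae] with p hp
    rw [hp]
  have hψc : ∀ i, (fun t => ψ (i, t) * c' i t) =ᵐ[volume.restrict M.T]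
      fun t => ψ' i t * M.c i t := fun i => by
    filter_upwards [hcae i, hψ' i] with t h1 h2
    rw [h1, h2]
  refine ⟨φ', ψ', hfeas, ?_, fun i => ?_, ?_⟩
  · exact ((integrable_withDensity_ofReal_iff hμm hμ0).1 (hφi.congr hφ'.symm)).congr hφμ
  · exact (integrable_of_integrable_disjointDensity hcm hc0 hψm hψi i).congr (hψc i)
  · rw [integral_disjointDensity hcm hc0 hψm hψi, ← integral_congr_ae hφ',
      integral_withDensity_ofReal hμm hμ0, integral_congr_ae hφμ]
    congr 1
    exact Finset.sum_congr rfl fun i _ => integral_congr_ae (hψc i)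

/-- Measurable versions of the demand density, the capacities and the positive part of the value
that are pointwise dominated by the originals. -/
lemma exists_measurable_data [SigmaFinite ν] (M : MatchingModel d n A ν) :
    ∃ (μ' : EuclideanSpace ℝ (Fin d) × A → ℝ) (c' : Fin n → ℝ → ℝ)
      (v : (EuclideanSpace ℝ (Fin d) × A) × (Fin n × ℝ) → ℝ),
      (Measurable μ' ∧ (∀ p, 0 ≤ μ' p) ∧ (∀ p, p.1 ∈ M.X → μ' p ≤ M.demand p.1 p.2) ∧
        μ' =ᵐ[M.spaceTypeMeasure] fun p => M.demand p.1 p.2) ∧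
      ((∀ i, Measurable (c' i)) ∧ (∀ i t, 0 ≤ c' i t) ∧ (∀ i, ∀ t ∈ M.T, c' i t ≤ M.c i t) ∧
        ∀ i, c' i =ᵐ[volume.restrict M.T] M.c i) ∧
      IsBddDensity v ∧
      (∀ p i t, v (p, (i, t)) = 0 ∨ v (p, (i, t)) = M.value i p.1 p.2 t) ∧
      ∀ i, ∀ᵐ q ∂M.spaceTypeMeasure.prod (volume.restrict M.T),
        M.value i q.1.1 q.1.2 q.2 ≤ v (q.1, (i, q.2)) := by
  obtain ⟨μ', hμm, hμae, hμ⟩ := M.aemeasurable_demand.exists_measurable_eq_or_eq_zero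
    (s := {p | p.1 ∈ M.X}) M.ae_fst_mem_X
  choose c' hcm hcae hc using fun i =>
    (M.integrableOn_c i).aemeasurable.exists_measurable_eq_or_eq_zero M.ae_mem_T
  have hXT : ∀ᵐ p ∂M.spaceTypeMeasure.prod (volume.restrict M.T), p.1.1 ∈ M.X ∧ p.2 ∈ M.T :=
    (Measure.quasiMeasurePreserving_fst.ae M.ae_fst_mem_X).and
      (Measure.quasiMeasurePreserving_snd.ae M.ae_mem_T)
  have hW : ∀ i, AEMeasurable (fun p : (EuclideanSpace ℝ (Fin d) × A) × ℝ =>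
      max (M.value i p.1.1 p.1.2 p.2) 0) (M.spaceTypeMeasure.prod (volume.restrict M.T)) :=
    fun i => (M.aemeasurable_value i).max aemeasurable_const
  have hW' := fun i => (hW i).exists_measurable_eq_or_eq_zero
    (s := {p | p.1.1 ∈ M.X ∧ p.2 ∈ M.T}) hXT
  choose w hwm hwae hw using hW'
  have hμ0 : ∀ p, 0 ≤ μ' p := fun p => by
    rcases hμ p with h | ⟨hX, h⟩
    · exact h.ge
    · exact h ▸ M.demand_nonneg hX _
  have hc0 : ∀ i t, 0 ≤ c' i t := fun i t => by
    rcases hc i t with h | ⟨hT, h⟩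
    · exact h.ge
    · exact h ▸ (M.c_pos i t hT).le
  have hμle : ∀ p, p.1 ∈ M.X → μ' p ≤ M.demand p.1 p.2 := fun p hX => by
    rcases hμ p with h | ⟨_, h⟩
    · exact h ▸ M.demand_nonneg hX _
    · exact h.le
  have hcle : ∀ i, ∀ t ∈ M.T, c' i t ≤ M.c i t := fun i t hT => by
    rcases hc i t with h | ⟨_, h⟩
    · exact h ▸ (M.c_pos i t hT).le
    · exact h.le
  set v : (EuclideanSpace ℝ (Fin d) × A) × (Fin n × ℝ) → ℝ :=
    fun p => w p.2.1 (p.1, p.2.2) with hv_def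
  have hv : IsBddDensity v := by
    refine ⟨?_, fun p => ?_, M.r, fun p => ?_⟩
    -- The station index ranges over a countable set, so measurability for each station suffices.
    · have h1 : Measurable fun q : Fin n × ((EuclideanSpace ℝ (Fin d) × A) × ℝ) => w q.1 q.2 :=
        measurable_from_prod_countable_right hwm
      exact h1.comp (by fun_prop : Measurable fun p : (EuclideanSpace ℝ (Fin d) × A) ×
        (Fin n × ℝ) => (p.2.1, (p.1, p.2.2)))
    · rcases hw p.2.1 (p.1, p.2.2) with h | ⟨_, h⟩
      · exact h.ge
      · exact (le_max_right _ _).trans h.ge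
    · rcases hw p.2.1 (p.1, p.2.2) with h | ⟨hm, h⟩
      · exact h.le.trans M.r_pos.le
      · exact h.le.trans (max_le (M.value_le_r _ _ _ hm.2) M.r_pos.le)
  have hvv : ∀ p i t, v (p, (i, t)) = 0 ∨ v (p, (i, t)) = M.value i p.1 p.2 t := by
    intro p i t
    rcases hw i (p, t) with h | ⟨_, h⟩
    · exact Or.inl h
    · rcases max_choice (M.value i p.1 p.2 t) 0 with h' | h'
      · exact Or.inr (h.trans h')
      · exact Or.inl (h.trans h')
  refine ⟨μ', c', v, ⟨hμm, hμ0, hμle, hμae⟩, ⟨hcm, hc0, hcle, hcae⟩, hv, hvv, fun i => ?_⟩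
  filter_upwards [hwae i] with q hq
  exact (le_max_left _ _).trans hq.ge

/-- There are dual values arbitrarily close to any upper bound of the primal values. -/
lemma exists_dualValue_le [SigmaFinite ν] (M : MatchingModel d n A ν) {V : ℝ}
    (hV : V ∈ upperBounds M.primalValues) {ε : ℝ} (hε : 0 < ε) :
    ∃ w ∈ M.dualValues, w ≤ V + ε := by
  obtain ⟨μ', c', v, ⟨hμm, hμ0, hμle, hμae⟩, ⟨hcm, hc0, hcle, hcae⟩, hv, hvv, hvae⟩ :=
    M.exists_measurable_data
  have hμi : Integrable μ' M.spaceTypeMeasure := M.integrable_demand.congr hμae.symm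
  have hci : ∀ i, Integrable (c' i) (volume.restrict M.T) := fun i =>
    (M.integrableOn_c i).congr (hcae i).symm
  have hB := boundsSubcouplings_of_mem_upperBounds hV hμm hμ0 hμi hμle hcm hc0 hci hcle hv hvv
  have := isFiniteMeasure_disjointDensity hci
  have := isFiniteMeasure_withDensity_ofReal hμi.2
  obtain ⟨φ, ψ, hφm, hψm, hφ0, hψ0, hφi, hψi, hle, hval⟩ := hB.exists_potentials hv hε
  refine ⟨_, M.integral_add_integral_mem_dualValues hμm hμ0 hμae hcm hc0 hcae hφm hψm hφ0 hψ0
    hφi hψi ?_, hval⟩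
  -- The constraint is needed only for almost every point with respect to the demand-weighted
  -- measure: points without demand contribute nothing to the dual objective, whatever potential
  -- they receive.
  have hv' : ∀ᵐ p ∂M.spaceTypeMeasure.withDensity fun p => ENNReal.ofReal (μ' p), ∀ i,
      ∀ᵐ t ∂volume.restrict M.T, M.value i p.1 p.2 t ≤ v (p, (i, t)) := by
    rw [ae_all_iff]
    exact fun i => (withDensity_absolutelyContinuous _ _).ae_le
      (Measure.ae_ae_of_ae_prod (hvae i))
  filter_upwards [hv', Measure.ae_ae_of_ae_prod hle] with p hp1 hp2 i
  filter_upwards [hp1 i, ae_of_ae_disjointDensity hcm hp2 i, hcae i, M.ae_mem_T]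
    with t h1 h2 h3 h4
  exact h1.trans (h2 (h3 ▸ M.c_pos i t h4))

lemma zero_mem_primalValues (M : MatchingModel d n A ν) : (0 : ℝ) ∈ M.primalValues := by
  refine ⟨fun _ _ => 0, ⟨fun i => measurable_const, fun _ _ _ _ _ _ => le_rfl,
    fun i => integrable_zero _ _ _, ?_, ?_⟩, ?_, ?_⟩ <;> simp

/-- The constant `M.r` dominates every value and total demand is finite. With weak duality this
bounds the primal values from above. -/
lemma dualValues_nonempty [SigmaFinite ν] (M : MatchingModel d n A ν) :
    M.dualValues.Nonempty := by
  refine ⟨_, fun _ => M.r, fun _ _ => 0, ⟨measurable_const, fun _ => measurable_const,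
    fun _ _ _ => M.r_pos.le, fun _ _ _ => le_rfl, fun i x _ α t ht => ?_⟩,
    M.integrable_demand.const_mul _, fun i => ?_, rfl⟩
  · simpa using M.value_le_r i x α ht
  · simp

end MatchingModel

/-! ### Strong duality -/

theorem mainTheorem3 {d n : ℕ} (hd : 2 ≤ d) {A : Type*} [MeasurableSpace A] (ν : Measure A)
    [SigmaFinite ν] (M : MatchingModel d n A ν) :
    ∃ V : ℝ, IsLUB M.primalValues V ∧ IsGLB M.dualValues V := by
  obtain ⟨w₀, hw₀⟩ := M.dualValues_nonempty
  have hlub : IsLUB M.primalValues (sSup M.primalValues) :=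
    isLUB_csSup ⟨0, M.zero_mem_primalValues⟩
      ⟨w₀, fun _ hw => MatchingModel.primalValue_le_dualValue hw hw₀⟩
  refine ⟨sSup M.primalValues, hlub, fun w hw => hlub.2 fun _ hu =>
    MatchingModel.primalValue_le_dualValue hu hw, fun b hb => ?_⟩
  refine le_of_forall_pos_le_add fun ε hε => ?_
  obtain ⟨w, hw, hle⟩ := M.exists_dualValue_le hlub.1 hε
  exact (hb hw).trans hle
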